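/- **Setting.** Let $d\ge 1$ and let $\Omega^{(x)}$, $\Omega^{(v)}$ be periodic domains in $\mathbb R^d$ (the second one is the computational velocity domain), each with a finite, not necessarily conforming, periodic triangulation $\mathcal T^{(x)}$, $\mathcal T^{(v)}$ by simplices. The faces $e\in\mathcal F^{(x)},\mathcal F^{(v)}$ are the $(d-1)$-dimensional intersections of neighbouring elements $T^-,T^+$ (modulo periodicity), with unit normal $\boldsymbol n^{(e)}$ pointing from $T^-$ to $T^+$ (the orientation is arbitrary), $\{U\}_e=\frac12(U_e^-+U_e^+)$ and $[U]_e=U_e^--U_e^+$. Let $\mathcal V^{(x)}$, $\mathcal V^{(v)}$ be the spaces of piecewise polynomials of total degree $\le p$, respectively $\le q$. Let $(\cdot,\cdot)_x$, $(\cdot,\cdot)_v$ be the $L^2$ inner products, $\omega(\boldsymbol v)=e^{-\|\boldsymbol v\|^2/2}$ and $(V,W)_{v,\omega}=(\omega V,W)_v$. For $y\in\{x,v\}$ the discrete derivatives are $$(\hat{\mathrm d}_{y_s}U,V)_y=\sum_T\int_T\partial_{y_s}U\,V\,d\boldsymbol y-\sum_e\int_e n^{(e)}_s[U]_e\{V\}_e\,dS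 .$$ **One time step.** Fix $\tau>0$, $m\ge1$ and functions $U_1,\dots,U_m\in\mathcal V^{(v)}$, orthonormal for $(\cdot,\cdot)_{v,\omega}$, with $1\in\operatorname{span}\{U_a\}$. At time $n$ one has $f^n=\omega\sum_{i,j=1}^{r}X^n_iS^n_{ij}V^n_j$, $r=r_n\ge m$, with $X^n_i\in\mathcal V^{(x)}$ $L^2$-orthonormal, $V^n_j\in\mathcal V^{(v)}$ $\omega$-orthonormal, $V^n_a=U_a$ for $a\le m$, and $S^n_{ab}=0$ for $a\le m<b$. Put $W^n_b=V^n_b$ for $b>m$. Let $\boldsymbol E^n$ be the electric field used in step $n$; it may be any vector field with components integrable on the elements of $\mathcal T^{(x)}$ (for instance, the field of the Poisson equation with density $\rho^n$). Set $A^{(x,s)}_{ij}=(v_sV_j^n,V_i^n)_{v,\omega}$, $B^{(x,s)}_{ij}=(\hat{\mathrm d}_{v_s}(\omega V_j^n),V^n_i)_v$, $A^{(v,s)}_{ij}=(-E^n_sX^n_j,X^n_i)_x$, $B^{(v,s)}_{ij}=(\hat{\mathrm d}_{x_s}X^n_j,X^n_i)_x$. * *K-step.* With $\boldsymbol K^n=(\sum_iX^n_iS^n_{ij})_j$,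 $\boldsymbol K^{n+1}\in(\mathcal V^{(x)})^r$ satisfies, for all $\boldsymbol\psi\in(\mathcal V^{(x)})^r$, $$\tfrac1\tau(\boldsymbol K^{n+1}-\boldsymbol K^n,\boldsymbol\psi)_x+\sum_T\sum_s\int_T\big[-A^{(x,s)}\boldsymbol K^n\cdot\partial_{x_s}\boldsymbol\psi-E^n_sB^{(x,s)}\boldsymbol K^n\cdot\boldsymbol\psi\big]d\boldsymbol x+\sum_e\int_e\Big(\sum_sn^{(e)}_sA^{(x,s)}\Big)\{\boldsymbol K^n\}_e\cdot[\boldsymbol\psi]_e\,dS=0 .$$ * *L-step.* Let $\widehat L_b^n$ ($b>m$) be the $L^2$-projection of $\omega\sum_{c>m}S^n_{bc}W^n_c$ to $\mathcal V^{(v)}$. Let $\widehat A^{(v,s)},\widehat B^{(v,s)}$ consist of the rows and columns with index $>m$, and $\bar A^{(v,s)},\bar B^{(v,s)}$ of the rows with index $>m$; let $\bar S=(S^n_{ia})_{i\le r,\,a\le m}$ and $\boldsymbol U=(U_a)_a$. Then $\widehat L_b^{n+1}\in\mathcal V^{(v)}$ satisfies $(\widehat L_b^{n+1},U_a)_v=0$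 and $$\begin{aligned}&\tfrac1\tau(\widehat{\boldsymbol L}^{n+1}-\widehat{\boldsymbol L}^n,\boldsymbol\psi)_v+\sum_T\sum_s\int_T\big[-\widehat A^{(v,s)}\widehat{\boldsymbol L}^n\cdot\partial_{v_s}\boldsymbol\psi+v_s\widehat B^{(v,s)}\widehat{\boldsymbol L}^n\cdot\boldsymbol\psi\big]d\boldsymbol v+\sum_e\int_e\Big(\sum_sn^{(e)}_s\widehat A^{(v,s)}\Big)\{\widehat{\boldsymbol L}^n\}_e\cdot[\boldsymbol\psi]_e\,dS\\&\qquad=-\sum_s\big(\bar A^{(v,s)}\bar S\,\partial_{v_s}(\omega\boldsymbol U)+v_s\bar B^{(v,s)}\bar S\,\omega\boldsymbol U,\boldsymbol\psi\big)_v\end{aligned}$$ for all $\boldsymbol\psi$ with components in $\mathcal V^{(v)}$ that are $\omega$-orthogonal to all $U_a$ (with piecewise derivatives $\partial_{v_s}$). $L^{n+1}_b\in\mathcal V^{(v)}$ is the function such that $\omega L^{n+1}_b$ has $L^2$-projection $\widehat L^{n+1}_b$ to $\mathcal V^{(v)}$. * *Augmentation.* $(\tilde X_\mu)$ is an $L^2$-orthonormal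 system in $\mathcal V^{(x)}$ whose span contains all $X^n_i,K^{n+1}_j$; $(\tilde V_\ell)$ is an $\omega$-orthonormal system in $\mathcal V^{(v)}$ whose span contains all $V^n_j,L^{n+1}_b$, with $\tilde V_a=U_a$ for $a\le m$. * *S-step.* $$\tilde S^{n+1}_{\mu\ell}=\sum_{ij}(\tilde X_\mu,X^n_i)_xS^n_{ij}(\tilde V_\ell,V^n_j)_{v,\omega}-\tau\sum_{ijs}\Big[(\hat{\mathrm d}_{x_s}X^n_i,\tilde X_\mu)_xS^n_{ij}(\tilde V_\ell,v_sV^n_j)_{v,\omega}+(\tilde X_\mu,-E^n_sX^n_i)_xS^n_{ij}(\hat{\mathrm d}_{v_s}(\omega V^n_j),\tilde V_\ell)_v\Big].$$ * *Truncation.* The part $\omega\sum_{a\le m}\sum_\mu\tilde X_\mu\tilde S^{n+1}_{\mu a}U_a$ is kept; in the remaining part $\omega\sum_{\ell>m}\sum_\mu\tilde X_\mu\tilde S^{n+1}_{\mu\ell}\tilde V_\ell$ the matrix $(\tilde S^{n+1}_{\mu\ell})_{\mu,\,\ell>m}$ is replaced by a truncated singular value decomposition of arbitrary size $r_{n+1}-m$.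 The result is written in the above format and is $f^{n+1}$. **Theorem.** Let $\rho^n=\int_{\Omega^{(v)}}f^n\,d\boldsymbol v$ and $\boldsymbol j^n=\int_{\Omega^{(v)}}\boldsymbol v f^n\,d\boldsymbol v$. For every sequence of such steps, starting from any $f^0$ in the above format, and all $n=0,1,2,\dots$ one has $\rho^n,j^n_s\in\mathcal V^{(x)}$ and $$\frac1\tau(\rho^{n+1}-\rho^n,\psi)_x-\sum_{T\in\mathcal T^{(x)}}\int_T\boldsymbol j^n\cdot\nabla\psi\,d\boldsymbol x+\sum_{e\in\mathcal F^{(x)}}\int_e\big(\boldsymbol n^{(e)}\cdot\{\boldsymbol j^n\}_e\big)[\psi]_e\,dS=0\qquad\text{for all }\psi\in\mathcal V^{(x)},$$ the explicit Euler DG discretization with central fluxes of $\partial_t\rho+\nabla\cdot\boldsymbol j=0$. Moreover the total mass is conserved: $\int_{\Omega^{(x)}}\rho^n\,d\boldsymbol x=\int_{\Omega^{(x)}}\rho^0\,d\boldsymbol x$ for all $n$. -/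

import Mathlib

open MeasureTheory

namespace DLRA

/-- `d`-dimensional Euclidean space. -/
abbrev Eu (d : ℕ) : Type := EuclideanSpace ℝ (Fin d)

/-- A (not necessarily conforming) periodic simplicial triangulation.  The periodic domain is the
torus `ℝ^d / lattice`; its elements are finitely many nondegenerate simplices of `ℝ^d` whose lattice
translates cover `ℝ^d` and have pairwise disjoint interiors.  (A periodic box is the case
`lattice = ⊕ ℓ_s ℤ`; that the lattice is discrete and of full rank follows from the tiling.)

A face `e` is the intersection `T⁻ ∩ (T⁺ + shift)` of two neighbouring elements, of positive
`(d-1)`-dimensional measure. Every pair of neighbours contributes exactly one face, with one of the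
two possible orientations, and `normal e` is the unit normal of `e` that points from `T⁻` to `T⁺`. -/
structure PeriodicMesh (d : ℕ) where
  lattice : AddSubgroup (Eu d)
  numElem : ℕ
  simplex : Fin numElem → Affine.Simplex ℝ (Eu d) d
  cover : ∀ x : Eu d, ∃ i, ∃ t ∈ lattice, x - t ∈ convexHull ℝ (Set.range (simplex i).points)
  disjoint : ∀ i j, ∀ t ∈ lattice, (i ≠ j ∨ t ≠ 0) →
    Disjoint (interior (convexHull ℝ (Set.range (simplex i).points)))
      (interior {x | x - t ∈ convexHull ℝ (Set.range (simplex j).points)})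
  numFace : ℕ
  minus : Fin numFace → Fin numElem
  plus : Fin numFace → Fin numElem
  shift : Fin numFace → Eu d
  shift_mem : ∀ e, shift e ∈ lattice
  face_ne : ∀ e, minus e ≠ plus e ∨ shift e ≠ 0
  face_measure : ∀ e, Measure.euclideanHausdorffMeasure (d - 1)
    (convexHull ℝ (Set.range (simplex (minus e)).points) ∩
      {x | x - shift e ∈ convexHull ℝ (Set.range (simplex (plus e)).points)}) ≠ 0
  face_unique : ∀ i j, ∀ t ∈ lattice, (i ≠ j ∨ t ≠ 0) →
    Measure.euclideanHausdorffMeasure (d - 1)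
      (convexHull ℝ (Set.range (simplex i).points) ∩
        {x | x - t ∈ convexHull ℝ (Set.range (simplex j).points)}) ≠ 0 →
    ∃! e, (minus e = i ∧ plus e = j ∧ shift e = t) ∨ (minus e = j ∧ plus e = i ∧ shift e = -t)
  normal : Fin numFace → Eu d
  normal_norm : ∀ e, ‖normal e‖ = 1
  normal_sep : ∀ e, ∀ x ∈ convexHull ℝ (Set.range (simplex (minus e)).points),
    ∀ y ∈ convexHull ℝ (Set.range (simplex (plus e)).points),
      inner ℝ (normal e) x ≤ inner ℝ (normal e) (y + shift e)

namespace PeriodicMesh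

/-- The (closed) element with index `i`. -/
def elem {d : ℕ} (M : PeriodicMesh d) (i : Fin M.numElem) : Set (Eu d) :=
  convexHull ℝ (Set.range (M.simplex i).points)

/-- The face with index `e`, placed on the boundary of its element `T⁻`. -/
def face {d : ℕ} (M : PeriodicMesh d) (e : Fin M.numFace) : Set (Eu d) :=
  M.elem (M.minus e) ∩ {x | x - M.shift e ∈ M.elem (M.plus e)}

/-- Piecewise defined functions on the periodic domain: the component `U i` describes the function
on the element `i` (including its one-sided limits on the boundary of that element). -/
abbrev Fn {d : ℕ} (M : PeriodicMesh d) : Type := Fin M.numElem → Eu d → ℝ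

/-- The DG space: piecewise polynomials of total degree at most `p`. (A polynomial function on `ℝ^d`
is determined by its restriction to an element, as elements have interior points.) -/
def dg {d : ℕ} (M : PeriodicMesh d) (p : ℕ) : Submodule ℝ M.Fn where
  carrier := {U | ∀ i, ∃ P : MvPolynomial (Fin d) ℝ, P.totalDegree ≤ p ∧
    ∀ x : Eu d, U i x = MvPolynomial.eval (fun s => x s) P}
  zero_mem' := fun _ => ⟨0, by simp, fun _ => by simp⟩
  add_mem' := by
    intro U V hU hV i
    obtain ⟨P, hP, hUP⟩ := hU i
    obtain ⟨Q, hQ, hVQ⟩ := hV i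
    exact ⟨P + Q, (MvPolynomial.totalDegree_add P Q).trans (max_le hP hQ), fun x => by
      simp [hUP x, hVQ x]⟩
  smul_mem' := by
    intro c U hU i
    obtain ⟨P, hP, hUP⟩ := hU i
    exact ⟨c • P, (MvPolynomial.totalDegree_smul_le c P).trans hP, fun x => by
      simp [hUP x]⟩

/-- The integral over the periodic domain. -/
noncomputable def integral {d : ℕ} (M : PeriodicMesh d) (U : M.Fn) : ℝ :=
  ∑ i, ∫ x in M.elem i, U i x

/-- The `L²` inner product `(U, V)`. -/
noncomputable def ip {d : ℕ} (M : PeriodicMesh d) (U V : M.Fn) : ℝ :=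
  M.integral fun i x => U i x * V i x

/-- The piecewise partial derivative in the coordinate direction `s`. -/
noncomputable def pd {d : ℕ} (M : PeriodicMesh d) (s : Fin d) (U : M.Fn) : M.Fn :=
  fun i x => fderiv ℝ (U i) x (EuclideanSpace.single s 1)

/-- The one-sided limit of `U` on the face `e` from the side of `T⁻`. -/
def traceMinus {d : ℕ} (M : PeriodicMesh d) (e : Fin M.numFace) (U : M.Fn) : Eu d → ℝ :=
  fun y => U (M.minus e) y

/-- The one-sided limit of `U` on the face `e` from the side of `T⁺`. -/
def tracePlus {d : ℕ} (M : PeriodicMesh d) (e : Fin M.numFace) (U : M.Fn) : Eu d → ℝ :=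
  fun y => U (M.plus e) (y - M.shift e)

/-- The average `{U}_e`. -/
noncomputable def avg {d : ℕ} (M : PeriodicMesh d) (e : Fin M.numFace) (U : M.Fn) : Eu d → ℝ :=
  fun y => (1 / 2) * (M.traceMinus e U y + M.tracePlus e U y)

/-- The jump `[U]_e = U⁻ - U⁺`. -/
def jump {d : ℕ} (M : PeriodicMesh d) (e : Fin M.numFace) (U : M.Fn) : Eu d → ℝ :=
  fun y => M.traceMinus e U y - M.tracePlus e U y

/-- The surface integral over the face `e`. -/
noncomputable def faceIntegral {d : ℕ} (M : PeriodicMesh d) (e : Fin M.numFace)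
    (g : Eu d → ℝ) : ℝ :=
  ∫ y in M.face e, g y ∂(Measure.euclideanHausdorffMeasure (d - 1))

/-- The discrete partial derivative, tested with `V`: the number `(d̂_{y_s} U, V)`. -/
noncomputable def discDeriv {d : ℕ} (M : PeriodicMesh d) (s : Fin d) (U V : M.Fn) : ℝ :=
  M.ip (M.pd s U) V - ∑ e, M.faceIntegral e fun y => M.normal e s * M.jump e U y * M.avg e V y

/-- The explicit Euler DG discretization with central fluxes `F*_e = A_e {U}_e`,
`A_e = ∑_s n_s A_s`, of the Friedrichs system `∂_t U + ∑_s (A_s ∂_s U + c_s B_s U) = 0`: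
the left-hand side of the scheme for the step from `U` to `U'`, tested with `Ψ`. -/
noncomputable def eulerForm {d : ℕ} (M : PeriodicMesh d) {ι : Type} [Fintype ι] (τ : ℝ)
    (A B : Fin d → Matrix ι ι ℝ) (c : Fin d → Eu d → ℝ) (U U' Ψ : ι → M.Fn) : ℝ :=
  (M.integral fun T y =>
    ∑ k, (1 / τ) * (U' k T y - U k T y) * Ψ k T y
      + ∑ s, (-(∑ k, (∑ l, A s k l * U l T y) * M.pd s (Ψ k) T y)
          + ∑ k, c s y * (∑ l, B s k l * U l T y) * Ψ k T y))
    + ∑ e, M.faceIntegral e fun y =>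
        ∑ k, (∑ l, (∑ s, M.normal e s * A s k l) * M.avg e (U l) y) * M.jump e (Ψ k) y

end PeriodicMesh

/-- The Gaussian weight `ω(v) = exp(-|v|²/2)`. -/
noncomputable def weight {d : ℕ} (v : Eu d) : ℝ := Real.exp (-‖v‖ ^ 2 / 2)

/-- Multiplication of a piecewise function by the weight. -/
noncomputable def wmul {d : ℕ} {M : PeriodicMesh d} (V : M.Fn) : M.Fn :=
  fun j v => weight v * V j v

/-- Multiplication of a piecewise function by the coordinate `v_s`. -/
def vmul {d : ℕ} {M : PeriodicMesh d} (s : Fin d) (V : M.Fn) : M.Fn :=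
  fun j v => v s * V j v

/-- The weighted inner product `(V, W)_{v,ω}`. -/
noncomputable def wip {d : ℕ} (M : PeriodicMesh d) (V W : M.Fn) : ℝ := M.ip (wmul V) W

/-- `Lhat` is the `L²` projection of `ω L` onto the DG space of degree `q`. -/
def IsWeightedProj {d : ℕ} (M : PeriodicMesh d) (q : ℕ) (L Lhat : M.Fn) : Prop :=
  Lhat ∈ M.dg q ∧ ∀ ψ ∈ M.dg q, M.ip Lhat ψ = M.ip (wmul L) ψ

/-- A low-rank representation `f = ω ∑ X_i S_ij V_j` of rank `r = m + k`. The index set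
`{1,…,r}` is written `Fin m ⊕ Fin k`; the velocity functions are `V = (U_1,…,U_m,W_1,…,W_k)`, where
only the `W_p` belong to the state since the `U_a` are fixed once and for all. -/
structure State {d : ℕ} (Mx Mv : PeriodicMesh d) (m : ℕ) where
  k : ℕ
  X : Fin m ⊕ Fin k → Mx.Fn
  S : Matrix (Fin m ⊕ Fin k) (Fin m ⊕ Fin k) ℝ
  W : Fin k → Mv.Fn

namespace State

/-- All velocity basis functions. -/
def V {d : ℕ} {Mx Mv : PeriodicMesh d} {m : ℕ} (st : State Mx Mv m) (U : Fin m → Mv.Fn) :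
    Fin m ⊕ Fin st.k → Mv.Fn :=
  Sum.elim U st.W

/-- `K_j = ∑_i X_i S_ij`. -/
noncomputable def K {d : ℕ} {Mx Mv : PeriodicMesh d} {m : ℕ} (st : State Mx Mv m) :
    Fin m ⊕ Fin st.k → Mx.Fn :=
  fun j => ∑ i, st.S i j • st.X i

/-- The block QR format: DG basis functions, `X` orthonormal, `V` orthonormal in the weighted inner
product, and `S` block lower triangular. -/
structure IsBlockQR {d : ℕ} {Mx Mv : PeriodicMesh d} {m : ℕ} (st : State Mx Mv m) (p q : ℕ)
    (U : Fin m → Mv.Fn) : Prop where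
  X_mem : ∀ i, st.X i ∈ Mx.dg p
  V_mem : ∀ j, st.V U j ∈ Mv.dg q
  X_orthonormal : ∀ i i', Mx.ip (st.X i) (st.X i') = if i = i' then 1 else 0
  V_orthonormal : ∀ j j', wip Mv (st.V U j) (st.V U j') = if j = j' then 1 else 0
  S_triangular : ∀ a p, st.S (Sum.inl a) (Sum.inr p) = 0

/-- The represented density `f(x,v) = ω(v) ∑_ij X_i(x) S_ij V_j(v)` on the product of the elements
`T` and `T'`. -/
noncomputable def density {d : ℕ} {Mx Mv : PeriodicMesh d} {m : ℕ} (st : State Mx Mv m)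
    (U : Fin m → Mv.Fn) (T : Fin Mx.numElem) (x : Eu d) (T' : Fin Mv.numElem) (v : Eu d) : ℝ :=
  weight v * ∑ i, ∑ j, st.X i T x * st.S i j * st.V U j T' v

/-- The mass density `ρ(x) = ∫ f(x,v) dv`. -/
noncomputable def rho {d : ℕ} {Mx Mv : PeriodicMesh d} {m : ℕ} (st : State Mx Mv m)
    (U : Fin m → Mv.Fn) : Mx.Fn :=
  fun T x => Mv.integral fun T' v => st.density U T x T' v

/-- The momentum density `j_s(x) = ∫ v_s f(x,v) dv`. -/
noncomputable def current {d : ℕ} {Mx Mv : PeriodicMesh d} {m : ℕ} (st : State Mx Mv m)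
    (U : Fin m → Mv.Fn) (s : Fin d) : Mx.Fn :=
  fun T x => Mv.integral fun T' v => v s * st.density U T x T' v

/-- `A^{(x,s)}_{ij} = (v_s V_j, V_i)_{v,ω}`. -/
noncomputable def Ax {d : ℕ} {Mx Mv : PeriodicMesh d} {m : ℕ} (st : State Mx Mv m)
    (U : Fin m → Mv.Fn) (s : Fin d) : Matrix (Fin m ⊕ Fin st.k) (Fin m ⊕ Fin st.k) ℝ :=
  Matrix.of fun i j => wip Mv (vmul s (st.V U j)) (st.V U i)

/-- `B_h^{(x,s)}_{ij} = (d̂_{v_s} (ω V_j), V_i)_v`. -/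
noncomputable def Bx {d : ℕ} {Mx Mv : PeriodicMesh d} {m : ℕ} (st : State Mx Mv m)
    (U : Fin m → Mv.Fn) (s : Fin d) : Matrix (Fin m ⊕ Fin st.k) (Fin m ⊕ Fin st.k) ℝ :=
  Matrix.of fun i j => Mv.discDeriv s (wmul (st.V U j)) (st.V U i)

/-- `A^{(v,s)}_{ij} = (-E_s X_j, X_i)_x`. -/
noncomputable def Av {d : ℕ} {Mx Mv : PeriodicMesh d} {m : ℕ} (st : State Mx Mv m)
    (E : Eu d → Eu d) (s : Fin d) : Matrix (Fin m ⊕ Fin st.k) (Fin m ⊕ Fin st.k) ℝ :=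
  Matrix.of fun i j => Mx.ip (fun T x => -(E x s) * st.X j T x) (st.X i)

/-- `B_h^{(v,s)}_{ij} = (d̂_{x_s} X_j, X_i)_x`. -/
noncomputable def Bv {d : ℕ} {Mx Mv : PeriodicMesh d} {m : ℕ} (st : State Mx Mv m)
    (s : Fin d) : Matrix (Fin m ⊕ Fin st.k) (Fin m ⊕ Fin st.k) ℝ :=
  Matrix.of fun i j => Mx.discDeriv s (st.X j) (st.X i)

/-- `S̄ = [S_ia]`, the columns of `S` that belong to the fixed velocity functions. -/
def Sbar {d : ℕ} {Mx Mv : PeriodicMesh d} {m : ℕ} (st : State Mx Mv m) :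
    Matrix (Fin m ⊕ Fin st.k) (Fin m) ℝ :=
  Matrix.of fun i a => st.S i (Sum.inl a)

/-- The right-hand side
`-∑_s (Ā^{(v,s)} S̄ ∂_{v_s}(ω U) + v_s B̄_h^{(v,s)} S̄ ω U, ψ)_v` of the L-step. -/
noncomputable def lSource {d : ℕ} {Mx Mv : PeriodicMesh d} {m : ℕ} (st : State Mx Mv m)
    (U : Fin m → Mv.Fn) (E : Eu d → Eu d) (ψ : Fin st.k → Mv.Fn) : ℝ :=
  -∑ s, ∑ p, Mv.ip
    (∑ a, ((st.Av E s * st.Sbar) (Sum.inr p) a • Mv.pd s (wmul (U a))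
      + (st.Bv s * st.Sbar) (Sum.inr p) a • vmul s (wmul (U a)))) (ψ p)

/-- The modified K-step from `K = K^n` to `K' = K^{n+1}`. -/
def IsKStep {d : ℕ} {Mx Mv : PeriodicMesh d} {m : ℕ} (st : State Mx Mv m) (p : ℕ)
    (U : Fin m → Mv.Fn) (τ : ℝ) (E : Eu d → Eu d) (K' : Fin m ⊕ Fin st.k → Mx.Fn) : Prop :=
  (∀ j, K' j ∈ Mx.dg p) ∧
  ∀ ψ : Fin m ⊕ Fin st.k → Mx.Fn, (∀ j, ψ j ∈ Mx.dg p) →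
    Mx.eulerForm τ (st.Ax U) (st.Bx U) (fun s x => -(E x s)) st.K K' ψ = 0

/-- The modified L-step, whose result is `L' = L^{n+1}`: `ω L_p = ω ∑_q S_pq W_q` is projected to
`L̂`, an explicit Euler step on the subspace orthogonal to the `U_a` gives `L̂'`, and `L'` is
recovered by inverting the projection. -/
def IsLStep {d : ℕ} {Mx Mv : PeriodicMesh d} {m : ℕ} (st : State Mx Mv m) (q : ℕ)
    (U : Fin m → Mv.Fn) (τ : ℝ) (E : Eu d → Eu d) (L' : Fin st.k → Mv.Fn) : Prop :=
  ∃ Lhat Lhat' : Fin st.k → Mv.Fn,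
    (∀ p, IsWeightedProj Mv q (∑ p', st.S (Sum.inr p) (Sum.inr p') • st.W p') (Lhat p)) ∧
    (∀ p, Lhat' p ∈ Mv.dg q) ∧
    (∀ p a, Mv.ip (Lhat' p) (U a) = 0) ∧
    (∀ ψ : Fin st.k → Mv.Fn, (∀ p, ψ p ∈ Mv.dg q) → (∀ p a, wip Mv (U a) (ψ p) = 0) →
      Mv.eulerForm τ (fun s => (st.Av E s).toBlocks₂₂) (fun s => (st.Bv s).toBlocks₂₂)
        (fun s v => v s) Lhat Lhat' ψ = st.lSource U E ψ) ∧
    (∀ p, L' p ∈ Mv.dg q) ∧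
    ∀ p, IsWeightedProj Mv q (L' p) (Lhat' p)

end State

/-- One time step, with step size `τ` and electric field `E`, of the conservative rank-adaptive
unconventional (BUG) integrator, from the state `st` to the state `st'`. -/
structure BUGStep {d : ℕ} {Mx Mv : PeriodicMesh d} {m : ℕ} (p q : ℕ) (U : Fin m → Mv.Fn)
    (τ : ℝ) (E : Eu d → Eu d) (st st' : State Mx Mv m) where
  /-- K-step -/
  K' : Fin m ⊕ Fin st.k → Mx.Fn
  kStep : st.IsKStep p U τ E K'
  /-- L-step -/
  L' : Fin st.k → Mv.Fn
  lStep : st.IsLStep q U τ E L'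
  /-- Basis augmentation: `Xt` is an orthonormal basis for `[X^n, K^{n+1}]`, and `(U, Wt)` is an
  orthonormal basis for `[V^n, L^{n+1}]`. If the functions to be spanned are linearly dependent, the
  bases may, but need not, be padded by further functions. -/
  rx : ℕ
  Xt : Fin rx → Mx.Fn
  Xt_mem : ∀ μ, Xt μ ∈ Mx.dg p
  Xt_orthonormal : ∀ μ μ', Mx.ip (Xt μ) (Xt μ') = if μ = μ' then 1 else 0
  X_mem_span : ∀ i, st.X i ∈ Submodule.span ℝ (Set.range Xt)
  K_mem_span : ∀ j, K' j ∈ Submodule.span ℝ (Set.range Xt)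
  rv : ℕ
  Wt : Fin rv → Mv.Fn
  Wt_mem : ∀ π, Wt π ∈ Mv.dg q
  Vt_orthonormal : ∀ l l' : Fin m ⊕ Fin rv,
    wip Mv (Sum.elim U Wt l) (Sum.elim U Wt l') = if l = l' then 1 else 0
  V_mem_span : ∀ j, st.V U j ∈ Submodule.span ℝ (Set.range (Sum.elim U Wt))
  L_mem_span : ∀ p, L' p ∈ Submodule.span ℝ (Set.range (Sum.elim U Wt))
  /-- S-step: the old coefficients in the augmented bases are `∑_ij M_μi S_ij N_lj`. -/
  St : Matrix (Fin rx) (Fin m ⊕ Fin rv) ℝ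
  sStep : ∀ μ l, St μ l =
    (∑ i, ∑ j, Mx.ip (Xt μ) (st.X i) * st.S i j * wip Mv (Sum.elim U Wt l) (st.V U j))
    - τ * ∑ i, ∑ j, ∑ s,
      (Mx.discDeriv s (st.X i) (Xt μ) * st.S i j
          * wip Mv (Sum.elim U Wt l) (vmul s (st.V U j))
        + Mx.ip (Xt μ) (fun T x => -(E x s) * st.X i T x) * st.S i j
          * Mv.discDeriv s (wmul (st.V U j)) (Sum.elim U Wt l))
  /-- Rank truncation: the part of the solution that belongs to the fixed functions `U_a` is kept;
  in the remaining part the matrix `R = [St_{μπ}]` is replaced by `R Q Qᵀ`, where the columns of `Q`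
  are an orthonormal basis of a leading right singular subspace of `R` (truncated singular value
  decomposition to an arbitrary rank `st'.k`). -/
  Q : Matrix (Fin rv) (Fin st'.k) ℝ
  Q_orthonormal : Q.transpose * Q = 1
  Q_leading : ∀ Q₁ : Matrix (Fin rv) (Fin st'.k) ℝ, Q₁.transpose * Q₁ = 1 →
    ((St.toCols₂ * Q₁).transpose * (St.toCols₂ * Q₁)).trace
      ≤ ((St.toCols₂ * Q).transpose * (St.toCols₂ * Q)).trace
  W_new : ∀ p, st'.W p = ∑ π, Q π p • Wt π
  /-- The new state is the truncated solution, brought into block QR format. -/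
  K_fixed : ∀ a, st'.K (Sum.inl a) = ∑ μ, St μ (Sum.inl a) • Xt μ
  K_trunc : ∀ p, st'.K (Sum.inr p) = ∑ μ, (St.toCols₂ * Q) μ p • Xt μ
  blockQR : st'.IsBlockQR p q U

end DLRA

/-! The balance for `ρ` is a fixed linear combination of the K-step equations. Write `1 = ∑ c_a
U_a`. Orthonormality of the `V_j` gives `ρ = ∑ c_a K_a`, and since `A^{(x,s)}_{aj} = (v_s V_j,
U_a)_{v,ω}`, the same combination of the K-step fluxes is `j_s` (`State.rho_eq`,
`State.current_eq`). The electric terms cancel because `∑ c_a B^{(x,s)}_{aj} = (d̂_{v_s}(ω V_j),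
1)_v = 0` (`State.IsBlockQR.sum_Bx_eq_zero`).

It remains to see that the new state inherits the functions `K_a`, `a ≤ m`, of the K-step. The `U_a`
belong to both the old and the augmented velocity basis, so column `a` of the S-step is the K-step
equation `a` tested with the `X̃_μ`. As `K_a^{n+1}` lies in their span, its coefficients are exactly
that column (`BUGStep.K_fixed_eq`), and truncation leaves it alone. Testing the balance with `ψ = 1`
then gives conservation of mass.

The identity `(d̂ G, 1) = 0` and the passage between the weak form of the K-step and the strong form
of the S-step both rest on discrete integration by parts (`discDeriv_eq_weak`). This is the
divergence theorem on the periodic mesh (`integral_pd_eq_sum_jump`) combined with `[GH] = [G]{H} +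
{G}[H]`. Since the mesh may be nonconforming, the boundary of an element is decomposed into its
contacts with translated elements rather than into facets. The proof slices: almost every line
parallel to an axis meets an element in a segment or not at all, the fundamental theorem of calculus
produces the two end values, and each end lies on exactly one face (`ae_existsUnique_piece`).
Surface integrals enter through their projections along the axis, with Jacobian `|n_s|`
(`exists_lift`). -/

namespace DLRA

/-! ### Coordinates along an axis -/

/-- Forget the coordinate `s`. -/
def proj {k : ℕ} (s : Fin (k + 1)) : Eu (k + 1) →ₗ[ℝ] Eu k where
  toFun y := WithLp.toLp 2 fun j => y (s.succAbove j)
  map_add' _ _ := rfl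
  map_smul' _ _ := rfl

/-- Insert `t` as coordinate `s`. -/
def ins {k : ℕ} (s : Fin (k + 1)) (x : Eu k) (t : ℝ) : Eu (k + 1) :=
  WithLp.toLp 2 (s.insertNth (α := fun _ => ℝ) t x)

section Coordinates

variable {k : ℕ} (s : Fin (k + 1))

@[simp] lemma proj_apply (y : Eu (k + 1)) (j : Fin k) : proj s y j = y (s.succAbove j) := rfl

@[simp] lemma ins_apply_same (x : Eu k) (t : ℝ) : ins s x t s = t := by simp [ins]

@[simp] lemma ins_apply_succAbove (x : Eu k) (t : ℝ) (j : Fin k) :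
    ins s x t (s.succAbove j) = x j := by simp [ins]

@[simp] lemma proj_ins (x : Eu k) (t : ℝ) : proj s (ins s x t) = x := by ext j; simp

lemma eq_of_proj_eq {y z : Eu (k + 1)} (h : proj s y = proj s z) (hs : y s = z s) : y = z := by
  ext i
  rcases Fin.eq_self_or_eq_succAbove s i with rfl | ⟨j, rfl⟩
  · exact hs
  · simpa using congrArg (fun w : Eu k => w j) h

@[simp] lemma ins_proj (y : Eu (k + 1)) : ins s (proj s y) (y s) = y :=
  eq_of_proj_eq s (by simp) (by simp)

lemma ins_eq_iff {x : Eu k} {t : ℝ} {y : Eu (k + 1)} : ins s x t = y ↔ proj s y = x ∧ y s = t :=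
  ⟨fun h => by simp [← h], fun ⟨h, h'⟩ => eq_of_proj_eq s (by simp [h]) (by simp [h'])⟩

@[simp] lemma proj_single (a : ℝ) : proj s (EuclideanSpace.single s a) = 0 := by
  ext j; simp [Fin.succAbove_ne]

lemma ins_add (x : Eu k) (t a : ℝ) :
    ins s x (t + a) = ins s x t + a • EuclideanSpace.single s (1 : ℝ) := by
  apply eq_of_proj_eq s <;> simp

lemma norm_sq_eq_proj (y : Eu (k + 1)) : ‖y‖ ^ 2 = ‖proj s y‖ ^ 2 + (y s) ^ 2 := by
  simp [EuclideanSpace.norm_sq_eq, Fin.sum_univ_succAbove _ s, add_comm]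

lemma norm_proj_le (y : Eu (k + 1)) : ‖proj s y‖ ≤ ‖y‖ := by
  have := norm_sq_eq_proj s y
  exact abs_le_of_sq_le_sq' (by nlinarith [sq_nonneg (y s)]) (norm_nonneg _) |>.2

lemma continuous_proj : Continuous (proj s : Eu (k + 1) → Eu k) :=
  LinearMap.continuous_of_finiteDimensional _

lemma lipschitz_proj : LipschitzWith 1 (proj s : Eu (k + 1) → Eu k) :=
  LipschitzWith.of_dist_le_mul fun x y => by
    simpa [dist_eq_norm, ← map_sub] using norm_proj_le s (x - y)

lemma surjective_proj : Function.Surjective (proj s : Eu (k + 1) → Eu k) :=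
  fun x => ⟨ins s x 0, by simp⟩

lemma continuous_ins : Continuous fun w : Eu k × ℝ => ins s w.1 w.2 := by
  unfold ins
  fun_prop

lemma isometry_ins (t : ℝ) : Isometry fun x : Eu k => ins s x t := by
  refine Isometry.of_dist_eq fun x y => ?_
  have h := norm_sq_eq_proj s (ins s x t - ins s y t)
  simp only [map_sub, proj_ins, PiLp.sub_apply, ins_apply_same, sub_self] at h
  rw [dist_eq_norm, dist_eq_norm, ← abs_of_nonneg (norm_nonneg (ins s x t - ins s y t)),
    ← abs_of_nonneg (norm_nonneg (x - y)), ← sq_eq_sq_iff_abs_eq_abs, h]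
  simp

/-- Splitting off one coordinate preserves the volume. -/
lemma measurePreserving_ins :
    MeasurePreserving (fun w : Eu k × ℝ => ins s w.1 w.2) volume volume := by
  have h1 := (volume_preserving_piFinSuccAbove (fun _ : Fin (k + 1) => ℝ) s).symm
  have h2 : MeasurePreserving (fun w : Eu k × ℝ => (w.2, (w.1 : Fin k → ℝ))) volume volume :=
    (Measure.measurePreserving_swap (μ := (volume : Measure (Fin k → ℝ)))
      (ν := (volume : Measure ℝ))).comp
      ((PiLp.volume_preserving_ofLp (Fin k)).prod (MeasurePreserving.id (volume : Measure ℝ)))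
  exact (PiLp.volume_preserving_toLp (Fin (k + 1))).comp (h1.comp h2)

lemma measurableEmbedding_ins :
    MeasurableEmbedding (fun w : Eu k × ℝ => ins s w.1 w.2) := by
  refine (continuous_ins s).measurableEmbedding fun w w' h => ?_
  have h1 := congrArg (proj s) h
  have h2 := congrArg (fun y : Eu (k + 1) => y s) h
  ext1
  · simpa using h1
  · simpa using h2

/-! ### Surface measure on hyperplanes -/

/-- A hyperplane with unit normal `n` is parametrized by an isometry whose projection along the
axis `s` is affine with determinant `± n_s`. -/
lemma exists_isometry_hyperplane {n : Eu (k + 1)} (hn : ‖n‖ = 1) (c : ℝ) :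
    ∃ (φ : Eu k → Eu (k + 1)) (A : Eu k →ₗ[ℝ] Eu k) (b : Eu k), Isometry φ ∧
      (∀ y, inner ℝ n y = c ↔ y ∈ Set.range φ) ∧ (∀ z, proj s (φ z) = b + A z) ∧
      |LinearMap.det A| = |n s| := by
  -- Complete `n` to an orthonormal basis with `e s = n`; the other basis vectors span the
  -- directions of the hyperplane, and `A` is the minor of the basis matrix without row and column
  -- `s`.
  have ho : Orthonormal ℝ (({s} : Set (Fin (k + 1))).domRestrict fun _ => n) := by
    refine ⟨fun _ => hn, fun i j hij => (hij (Subsingleton.elim i j)).elim⟩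
  obtain ⟨e, he⟩ := ho.exists_orthonormalBasis_extension_of_card_eq (by simp)
  have hes : e s = n := he s rfl
  let M : Matrix (Fin (k + 1)) (Fin (k + 1)) ℝ := Matrix.of fun i j => e j i
  have hM : M.transpose * M = 1 := by
    ext i j
    have := orthonormal_iff_ite.mp e.orthonormal i j
    simp only [PiLp.inner_apply, RCLike.inner_apply, conj_trivial] at this
    simp only [Matrix.mul_apply, Matrix.transpose_apply, M, Matrix.of_apply, Matrix.one_apply,
      ← this]
    exact Finset.sum_congr rfl fun _ _ => mul_comm _ _
  refine ⟨fun z => c • n + e.repr.symm (ins s z 0),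
    Matrix.toEuclideanLin (M.submatrix s.succAbove s.succAbove), proj s (c • n), ?_, ?_, ?_, ?_⟩
  · refine Isometry.of_dist_eq fun x y => ?_
    rw [dist_add_left, e.repr.symm.dist_map, (isometry_ins s 0).dist_eq]
  · intro y
    have hr : ∀ y, e.repr y s = inner ℝ n y := fun y => by rw [e.repr_apply_apply, hes]
    constructor
    · intro hy
      refine ⟨proj s (e.repr (y - c • n)), ?_⟩
      have h0 : e.repr (y - c • n) s = 0 := by
        rw [hr, inner_sub_right, hy, inner_smul_right, real_inner_self_eq_norm_sq, hn]
        ring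
      have := ins_proj s (e.repr (y - c • n))
      rw [h0] at this
      dsimp only
      rw [this]
      simp
    · rintro ⟨z, rfl⟩
      simp only [inner_add_right, inner_smul_right, real_inner_self_eq_norm_sq, hn]
      rw [← hr]
      simp
  · intro z
    rw [map_add]
    congr 1
    ext i
    rw [← e.sum_repr_symm]
    simp [Fin.sum_univ_succAbove _ s, Matrix.mulVec, dotProduct, M]
    exact Finset.sum_congr rfl fun _ _ => mul_comm _ _
  · have h1 : LinearMap.det (Matrix.toEuclideanLin (M.submatrix s.succAbove s.succAbove))
        = (M.submatrix s.succAbove s.succAbove).det := by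
      rw [Matrix.toEuclideanLin, Matrix.toLpLin_eq_toLin, LinearMap.det_toLin]
    -- For an orthogonal matrix the adjugate is `det M • Mᵀ`, so the `(s, s)` cofactor is `± M s s =
    -- ± n s`.
    have h2 := Matrix.adjugate_fin_succ_eq_det_submatrix M s s
    have hdet : M.det * M.det = 1 := by
      have := congrArg Matrix.det hM
      simpa using this
    have h3 : M.adjugate = M.det • M.transpose := by
      calc M.adjugate = (M.transpose * M) * M.adjugate := by rw [hM, one_mul]
        _ = _ := by rw [mul_assoc, Matrix.mul_adjugate]; simp
    rw [h3] at h2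
    have h4 : M.det * n s = (M.submatrix s.succAbove s.succAbove).det := by
      simpa [M, hes, ← two_mul, pow_mul] using h2
    rw [h1, ← h4, abs_mul]
    have : |M.det| = 1 := by
      rw [← sq_eq_sq₀ (abs_nonneg _) zero_le_one, sq_abs]; nlinarith
    rw [this, one_mul]

/-- The projection of a piece of a hyperplane that contains the direction of projection is null. -/
lemma volume_proj_image_eq_zero_of_normal {n : Eu (k + 1)} (hn : ‖n‖ = 1) (hs : n s = 0) {c : ℝ}
    {P : Set (Eu (k + 1))} (hP : ∀ y ∈ P, inner ℝ n y = c) : volume (proj s '' P) = 0 := by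
  obtain ⟨φ, A, b, -, hr, hA, hdet⟩ := exists_isometry_hyperplane s hn c
  have hsub : proj s '' P ⊆ (fun z => b + z) '' (A '' Set.univ) := by
    rintro _ ⟨y, hy, rfl⟩
    obtain ⟨z, rfl⟩ := (hr y).1 (hP y hy)
    exact ⟨A z, ⟨z, trivial, rfl⟩, (hA z).symm⟩
  refine measure_mono_null hsub ?_
  have h0 : LinearMap.det A = 0 := by rw [← abs_eq_zero, hdet, hs, abs_zero]
  rw [Set.image_add_left, measure_preimage_add, Measure.addHaar_image_linearMap, h0]
  simp

/-- Surface integrals over a piece of a hyperplane as integrals over the projection. -/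
lemma exists_lift {n : Eu (k + 1)} (hn : ‖n‖ = 1) (hs : n s ≠ 0) (c : ℝ) :
    ∃ lift : Eu k → Eu (k + 1), Continuous lift ∧ (∀ x, proj s (lift x) = x) ∧
      (∀ x, inner ℝ n (lift x) = c) ∧
      ∀ (P : Set (Eu (k + 1))), MeasurableSet P → (∀ y ∈ P, inner ℝ n y = c) →
        ∀ F : Eu (k + 1) → ℝ,
          |n s| * ∫ y in P, F y ∂(Measure.euclideanHausdorffMeasure k)
            = ∫ x, (lift ⁻¹' P).indicator (F ∘ lift) x := by
  obtain ⟨φ, A, b, hφ, hr, hA, hdet⟩ := exists_isometry_hyperplane s hn c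
  have h0 : LinearMap.det A ≠ 0 := by rw [← abs_ne_zero, hdet]; exact abs_ne_zero.2 hs
  -- Since `n s ≠ 0`, the projected chart `z ↦ b + A z` is invertible; its inverse followed by `φ`
  -- lifts a point back to the hyperplane.
  let e : Eu k ≃ₗ[ℝ] Eu k := LinearMap.equivOfDetNeZero A h0
  have he : ∀ z, e z = A z := fun z => rfl
  have hec : Continuous e.symm :=
    LinearMap.continuous_of_finiteDimensional (e.symm : Eu k →ₗ[ℝ] Eu k)
  have hlc : Continuous fun x : Eu k => φ (e.symm (x - b)) :=
    hφ.continuous.comp (hec.comp (by fun_prop))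
  refine ⟨fun x => φ (e.symm (x - b)), hlc, ?_, ?_, ?_⟩
  · intro x
    rw [hA, ← he]
    simp
  · exact fun x => (hr _).2 ⟨_, rfl⟩
  · intro P hP hPc F
    have hPr : P ⊆ Set.range φ := fun y hy => (hr y).1 (hPc y hy)
    have hemb : MeasurableEmbedding φ := hφ.isClosedEmbedding.measurableEmbedding
    have h1 : ∫ y in P, F y ∂(Measure.euclideanHausdorffMeasure k)
        = ∫ z, (P.indicator F) (φ z) := by
      rw [← EuclideanSpace.euclideanHausdorffMeasure_eq_volume, ← hemb.integral_map,
        hφ.map_euclideanHausdorffMeasure, setIntegral_indicator hP,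
        Set.inter_eq_self_of_subset_right hPr]
    have h2 : ∫ z, (P.indicator F) (φ z)
        = |LinearMap.det A|⁻¹ * ∫ x, (P.indicator F) (φ (e.symm (x - b))) := by
      rw [integral_sub_right_eq_self (fun x => (P.indicator F) (φ (e.symm x))) b]
      have h3 := Measure.map_linearMap_addHaar_eq_smul_addHaar (volume : Measure (Eu k)) h0
      have hAm : MeasurableEmbedding A :=
        (e.toContinuousLinearEquiv.toHomeomorph).measurableEmbedding
      have h4 := hAm.integral_map (μ := volume) fun x => (P.indicator F) (φ (e.symm x))
      rw [h3, integral_smul_measure] at h4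
      have h5 : ∀ z, e.symm (A z) = z := fun z => by rw [← he]; simp
      simp only [h5] at h4
      rw [← h4, ENNReal.toReal_ofReal (abs_nonneg _), abs_inv, smul_eq_mul]
    rw [h1, h2, hdet, ← mul_assoc, mul_inv_cancel₀ (abs_ne_zero.2 hs), one_mul]
    rfl

end Coordinates

/-! ### The divergence theorem on a convex body -/

section ConvexBody

variable {k : ℕ} (s : Fin (k + 1))

lemma isOpenMap_proj : IsOpenMap (proj s : Eu (k + 1) → Eu k) :=
  (proj s).isOpenMap_of_finiteDimensional (surjective_proj s)

/-- Almost every line that meets a convex body meets its interior. -/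
lemma ae_mem_proj_interior {A : Set (Eu (k + 1))} (hA : Convex ℝ A) (hi : (interior A).Nonempty) :
    ∀ᵐ x : Eu k, x ∈ proj s '' A → x ∈ proj s '' interior A := by
  have hC : Convex ℝ (proj s '' interior A) := hA.interior.linear_image _
  -- A convex set has null frontier. The projection of `A` lies in the closure of the open convex
  -- set `proj s '' interior A`, hence off the frontier in that set itself.
  have h0 : ∀ᵐ x : Eu k, x ∉ frontier (proj s '' interior A) :=
    measure_eq_zero_iff_ae_notMem.1 (hC.addHaar_frontier volume)
  filter_upwards [h0] with x hx hxA
  have hcl : x ∈ closure (proj s '' interior A) := by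
    refine image_closure_subset_closure_image (continuous_proj s) ?_
    rw [hA.closure_interior_eq_closure_of_nonempty_interior hi]
    exact Set.image_mono subset_closure hxA
  by_contra hn
  rw [((isOpenMap_proj s) _ isOpen_interior).frontier_eq] at hx
  exact hx ⟨hcl, hn⟩

lemma inner_ins (n : Eu (k + 1)) (x : Eu k) (t t' : ℝ) :
    inner ℝ n (ins s x t) = inner ℝ n (ins s x t') + (t - t') * n s := by
  have : ins s x t = ins s x t' + (t - t') • EuclideanSpace.single s (1 : ℝ) := by
    rw [← ins_add]; congr 1; ring
  rw [this, inner_add_right, inner_smul_right, EuclideanSpace.inner_single_right]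
  simp

/-- The contribution of a flat boundary piece as an integral over the projection. -/
lemma exists_boundary_density {T P : Set (Eu (k + 1))} (hP : IsCompact P) (hPT : P ⊆ T)
    {n : Eu (k + 1)} (hn : ‖n‖ = 1) {c : ℝ} (hPn : ∀ y ∈ P, inner ℝ n y = c)
    (hTn : ∀ y ∈ T, inner ℝ n y ≤ c) {g : Eu (k + 1) → ℝ} (hg : Continuous g) :
    ∃ h : Eu k → ℝ, Integrable h ∧
      ∫ x, h x = n s * ∫ y in P, g y ∂(Measure.euclideanHausdorffMeasure k) ∧
      ∀ᵐ x, ((∀ t, ins s x t ∉ T) → h x = 0) ∧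
        ∀ α β : ℝ, α < β → (∀ t, ins s x t ∈ T ↔ t ∈ Set.Icc α β) →
          h x = P.indicator g (ins s x β) - P.indicator g (ins s x α) := by
  classical
  by_cases hs : n s = 0
  · refine ⟨0, integrable_zero _ _ _, by simp [hs], ?_⟩
    filter_upwards [measure_eq_zero_iff_ae_notMem.1
      (volume_proj_image_eq_zero_of_normal s hn hs hPn)] with x hx
    have hx' : ∀ t, ins s x t ∉ P := fun t ht => hx ⟨_, ht, by simp⟩
    simp [hx']
  obtain ⟨l, hlc, hlp, hln, hint⟩ := exists_lift s hn hs c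
  have hl : ∀ x, ins s x (l x s) = l x := fun x => by rw [ins_eq_iff]; exact ⟨hlp x, rfl⟩
  have hcomp : IsCompact (l ⁻¹' P) := by
    refine (hP.image (continuous_proj s)).of_isClosed_subset (hP.isClosed.preimage hlc) ?_
    exact fun x hx => ⟨l x, hx, hlp x⟩
  have hI : Integrable ((l ⁻¹' P).indicator (g ∘ l)) :=
    (integrable_indicator_iff hcomp.measurableSet).2
      ((hg.comp hlc).continuousOn.integrableOn_compact hcomp)
  have hval := hint P hP.measurableSet hPn g
  have huniq : ∀ x t, ins s x t ∈ P → t = l x s := by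
    intro x t ht
    have h1 := inner_ins s n x t (l x s)
    rw [hPn _ ht, hl, hln] at h1
    have : (t - l x s) * n s = 0 := by linarith
    rcases mul_eq_zero.1 this with h | h
    · linarith
    · exact (hs h).elim
  have hind : ∀ x, (l ⁻¹' P).indicator (g ∘ l) x = P.indicator g (ins s x (l x s)) := by
    intro x; rw [hl]; rfl
  have hout : ∀ x t, t ≠ l x s → P.indicator g (ins s x t) = 0 := fun x t ht =>
    Set.indicator_of_notMem (fun h => ht (huniq x t h)) _
  -- Along a line `⟨n, ·⟩` has slope `n s`, and its bound `c` on `T` is attained on `P`. Hence `P`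
  -- can meet the segment only at the lower end if `n s < 0`, and only at the upper end if `n s >
  -- 0`; the sign of the density follows.
  rcases lt_or_gt_of_ne hs with hneg | hpos
  · refine ⟨fun x => -(l ⁻¹' P).indicator (g ∘ l) x, hI.neg, ?_, ?_⟩
    · rw [integral_neg, ← hval, abs_of_neg hneg]; ring
    · refine Filter.Eventually.of_forall fun x => ⟨fun h => ?_, fun α β hαβ hT => ?_⟩
      · dsimp only
        rw [hind, Set.indicator_of_notMem (fun h' => h _ (hPT h')), neg_zero]
      · dsimp only
        rw [hind]
        by_cases hx : ins s x (l x s) ∈ P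
        · have hm := (hT _).1 (hPT hx)
          have h1 := hTn _ ((hT α).2 ⟨le_rfl, hαβ.le⟩)
          rw [inner_ins s n x α (l x s), hPn _ hx] at h1
          have h2 : α = l x s := le_antisymm hm.1 (by nlinarith)
          rw [hout x β (by rw [← h2]; exact hαβ.ne'), ← h2, zero_sub]
        · have h1 : ∀ t, ins s x t ∉ P := fun t ht => hx (by rwa [← huniq x t ht])
          simp [h1]
  · refine ⟨fun x => (l ⁻¹' P).indicator (g ∘ l) x, hI, ?_, ?_⟩
    · rw [← hval, abs_of_pos hpos]
    · refine Filter.Eventually.of_forall fun x => ⟨fun h => ?_, fun α β hαβ hT => ?_⟩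
      · dsimp only
        rw [hind, Set.indicator_of_notMem (fun h' => h _ (hPT h'))]
      · dsimp only
        rw [hind]
        by_cases hx : ins s x (l x s) ∈ P
        · have hm := (hT _).1 (hPT hx)
          have h1 := hTn _ ((hT β).2 ⟨hαβ.le, le_rfl⟩)
          rw [inner_ins s n x β (l x s), hPn _ hx] at h1
          have h2 : β = l x s := le_antisymm (by nlinarith) hm.2
          rw [hout x α (by rw [← h2]; exact hαβ.ne), ← h2, sub_zero]
        · have h1 : ∀ t, ins s x t ∉ P := fun t ht => hx (by rwa [← huniq x t ht])
          simp [h1]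

/-- Almost every line intersects a compact convex body in a nondegenerate segment or not at all. -/
lemma ae_slice {T : Set (Eu (k + 1))} (hT : IsCompact T) (hconv : Convex ℝ T)
    (hi : (interior T).Nonempty) :
    ∀ᵐ x : Eu k, (∀ t, ins s x t ∉ T) ∨
      ∃ α β : ℝ, α < β ∧ ∀ t, ins s x t ∈ T ↔ t ∈ Set.Icc α β := by
  filter_upwards [ae_mem_proj_interior s hconv hi] with x hx
  by_cases he : ∀ t, ins s x t ∉ T
  · exact Or.inl he
  right
  push Not at he
  obtain ⟨t₀, ht₀⟩ := he
  obtain ⟨y, hy, hyx⟩ := hx ⟨_, ht₀, by simp⟩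
  have hl : Continuous fun t : ℝ => ins s x t :=
    (continuous_ins s).comp (continuous_const.prodMk continuous_id)
  have hcompact : IsCompact {t : ℝ | ins s x t ∈ T} := by
    refine (hT.image (f := fun y : Eu (k + 1) => y s) (by fun_prop)).of_isClosed_subset
      (hT.isClosed.preimage hl) ?_
    exact fun t ht => ⟨_, ht, by simp⟩
  have hconvex : Convex ℝ {t : ℝ | ins s x t ∈ T} := by
    intro a ha b hb u v hu hv huv
    have : ins s x (u • a + v • b) = u • ins s x a + v • ins s x b := by
      apply eq_of_proj_eq s
      · simp [← add_smul, huv]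
      · simp
    exact (congrArg (· ∈ T) this).mpr (hconv ha hb hu hv huv)
  have hIcc := eq_Icc_of_connected_compact ⟨⟨t₀, ht₀⟩, hconvex.isPreconnected⟩ hcompact
  refine ⟨_, _, ?_, fun t => (Set.ext_iff.1 hIcc t)⟩
  -- The line passes through an interior point of `T`, which rules out a one-point intersection.
  have hnb : {t : ℝ | ins s x t ∈ T} ∈ nhds (y s) := by
    have : ins s x (y s) = y := by rw [← hyx]; simp
    exact hl.continuousAt.preimage_mem_nhds (by rw [this]; exact mem_interior_iff_mem_nhds.1 hy)
  rw [hIcc, Icc_mem_nhds_iff] at hnb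
  exact hnb.1.trans hnb.2

/-- The divergence theorem on a compact convex body whose boundary consists of flat pieces. -/
theorem setIntegral_fderiv_eq_sum_pieces {K : Type*} [Fintype K] {T : Set (Eu (k + 1))}
    (hT : IsCompact T) (hconv : Convex ℝ T) (hi : (interior T).Nonempty)
    {P : K → Set (Eu (k + 1))} (hP : ∀ κ, IsCompact (P κ)) (hPT : ∀ κ, P κ ⊆ T)
    {n : K → Eu (k + 1)} (hn : ∀ κ, ‖n κ‖ = 1) {c : K → ℝ}
    (hPn : ∀ κ, ∀ y ∈ P κ, inner ℝ (n κ) y = c κ) (hTn : ∀ κ, ∀ y ∈ T, inner ℝ (n κ) y ≤ c κ)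
    (hex : ∀ᵐ x : Eu k, ∀ y ∈ T, proj s y = x → ∀ σ : ℝ, σ ≠ 0 →
      (∀ ε : ℝ, 0 < ε → y + ε • EuclideanSpace.single s σ ∉ T) → ∃! κ, y ∈ P κ)
    {g : Eu (k + 1) → ℝ} (hg : ContDiff ℝ 1 g) :
    ∫ y in T, fderiv ℝ g y (EuclideanSpace.single s 1)
      = ∑ κ, n κ s * ∫ y in P κ, g y ∂(Measure.euclideanHausdorffMeasure k) := by
  classical
  set G : Eu (k + 1) → ℝ := fun y => fderiv ℝ g y (EuclideanSpace.single s 1) with hG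
  have hGc : Continuous G := by
    have := hg.continuous_fderiv one_ne_zero
    fun_prop
  choose h hhi hhe hh using fun κ =>
    exists_boundary_density s (hP κ) (hPT κ) (hn κ) (hPn κ) (hTn κ) hg.continuous
  have hGi : Integrable (T.indicator G) :=
    (integrable_indicator_iff hT.measurableSet).2 (hGc.continuousOn.integrableOn_compact hT)
  have hmp := measurePreserving_ins s
  have he := measurableEmbedding_ins s
  -- By Fubini both sides become integrals over the lines parallel to the axis, and the identity is
  -- checked line by line.
  rw [← integral_indicator hT.measurableSet, ← hmp.integral_comp he, Measure.volume_eq_prod,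
    integral_prod (fun w : Eu k × ℝ => T.indicator G (ins s w.1 w.2)) ((hmp.integrable_comp_emb he).2 hGi)]
  simp_rw [← hhe]
  rw [← integral_finsetSum _ fun κ _ => hhi κ]
  refine integral_congr_ae ?_
  filter_upwards [hex, ae_all_iff.2 hh, ae_slice s hT hconv hi] with x hx1 hx2 hx3
  rcases hx3 with hx3 | ⟨α, β, hαβ, hI⟩
  · rw [Finset.sum_eq_zero fun κ _ => (hx2 κ).1 hx3]
    simp [Set.indicator_of_notMem (hx3 _)]
  have hα : ins s x α ∈ T := (hI α).2 ⟨le_rfl, hαβ.le⟩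
  have hβ : ins s x β ∈ T := (hI β).2 ⟨hαβ.le, le_rfl⟩
  have hsum : ∀ y, (∃! κ, y ∈ P κ) → ∑ κ, (P κ).indicator g y = g y := by
    rintro y ⟨κ, hκ, hu⟩
    rw [Finset.sum_eq_single κ, Set.indicator_of_mem hκ]
    · exact fun κ' _ hne => Set.indicator_of_notMem (fun h' => hne (hu κ' h')) _
    · simp
  have hshift : ∀ t ε σ : ℝ,
      ins s x t + ε • EuclideanSpace.single s σ = ins s x (t + ε * σ) := by
    intro t ε σ
    apply eq_of_proj_eq s <;> simp
  -- The segment is left upwards at `β` and downwards at `α`, so each end lies in exactly one piece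
  -- and the densities add up to the difference of the end values of `g`.
  have hβ1 := hx1 _ hβ (by simp) 1 one_ne_zero (by
    intro ε hε hm
    rw [hshift, hI] at hm
    linarith [hm.2])
  have hα1 := hx1 _ hα (by simp) (-1) (by norm_num) (by
    intro ε hε hm
    rw [hshift, hI] at hm
    linarith [hm.1])
  rw [Finset.sum_congr rfl fun κ _ => (hx2 κ).2 α β hαβ hI, Finset.sum_sub_distrib,
    hsum _ hβ1, hsum _ hα1]
  have h1 : ∀ t, T.indicator G (ins s x t) = (Set.Icc α β).indicator (fun t => G (ins s x t)) t := by
    intro t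
    by_cases ht : t ∈ Set.Icc α β
    · rw [Set.indicator_of_mem ht, Set.indicator_of_mem ((hI t).2 ht)]
    · rw [Set.indicator_of_notMem ht, Set.indicator_of_notMem (fun h' => ht ((hI t).1 h'))]
  simp_rw [h1]
  have hl : Continuous fun t : ℝ => ins s x t :=
    (continuous_ins s).comp (continuous_const.prodMk continuous_id)
  rw [integral_indicator measurableSet_Icc, integral_Icc_eq_integral_Ioc,
    ← intervalIntegral.integral_of_le hαβ.le]
  refine intervalIntegral.integral_eq_sub_of_hasDerivAt (f := fun t => g (ins s x t)) ?_
    (hGc.comp hl).continuousOn.intervalIntegrable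
  intro t _
  have hd : HasDerivAt (fun t : ℝ => ins s x t) (EuclideanSpace.single s (1 : ℝ)) t := by
    have h2 : (fun t : ℝ => ins s x t)
        = fun t => ins s x 0 + t • EuclideanSpace.single s (1 : ℝ) := by
      funext t; rw [← ins_add, zero_add]
    rw [h2]
    simpa using ((hasDerivAt_id t).smul_const (EuclideanSpace.single s (1 : ℝ))).const_add
      (ins s x 0)
  exact ((hg.differentiable one_ne_zero) _).hasFDerivAt.comp_hasDerivAt t hd

end ConvexBody

namespace PeriodicMesh

/-! ### The tiling by translated elements -/

section Tiling

variable {d : ℕ} (M : PeriodicMesh d)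

/-- A translated element. -/
def tile (a : Fin M.numElem × Eu d) : Set (Eu d) := {x | x - a.2 ∈ M.elem a.1}

lemma tile_eq_preimage (a : Fin M.numElem × Eu d) :
    M.tile a = Homeomorph.subRight a.2 ⁻¹' M.elem a.1 := rfl

lemma tile_zero (i : Fin M.numElem) : M.tile (i, 0) = M.elem i := by simp [tile]

lemma convex_elem (i : Fin M.numElem) : Convex ℝ (M.elem i) := convex_convexHull _ _

lemma isCompact_elem (i : Fin M.numElem) : IsCompact (M.elem i) :=
  (Set.finite_range _).isCompact_convexHull ℝ

lemma interior_elem_nonempty (i : Fin M.numElem) : (interior (M.elem i)).Nonempty := by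
  rw [elem, interior_convexHull_nonempty_iff_affineSpan_eq_top]
  exact (M.simplex i).independent.affineSpan_eq_top_iff_card_eq_finrank_add_one.2 (by simp)

lemma interior_tile (a : Fin M.numElem × Eu d) :
    interior (M.tile a) = Homeomorph.subRight a.2 ⁻¹' interior (M.elem a.1) := by
  rw [tile_eq_preimage, Homeomorph.preimage_interior]

lemma convex_tile (a : Fin M.numElem × Eu d) : Convex ℝ (M.tile a) := by
  have := (M.convex_elem a.1).translate_preimage_left (-a.2)
  simpa [tile, sub_eq_add_neg] using! this

lemma isClosed_tile (a : Fin M.numElem × Eu d) : IsClosed (M.tile a) :=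
  (M.isCompact_elem a.1).isClosed.preimage (Homeomorph.subRight a.2).continuous

lemma interior_tile_nonempty (a : Fin M.numElem × Eu d) : (interior (M.tile a)).Nonempty := by
  rw [interior_tile]
  exact (M.interior_elem_nonempty a.1).preimage (Homeomorph.subRight a.2).surjective

lemma disjoint_interior_tile {a b : Fin M.numElem × Eu d} (ha : a.2 ∈ M.lattice)
    (hb : b.2 ∈ M.lattice) (hab : a ≠ b) :
    Disjoint (interior (M.tile a)) (interior (M.tile b)) := by
  have h := M.disjoint a.1 b.1 (b.2 - a.2) (sub_mem hb ha) (by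
    by_contra! hc
    exact hab (Prod.ext hc.1 (sub_eq_zero.1 hc.2).symm))
  rw [Set.disjoint_left] at h ⊢
  intro x hx hx'
  rw [interior_tile] at hx hx'
  refine h (a := x - a.2) hx ?_
  change x - a.2 ∈ interior (M.tile (b.1, b.2 - a.2))
  rw [interior_tile]
  simpa using hx'

/-- Only finitely many translated elements meet a given ball. -/
lemma finite_tiles (R : ℝ) :
    {a : Fin M.numElem × Eu d |
      a.2 ∈ M.lattice ∧ (M.tile a ∩ Metric.closedBall 0 R).Nonempty}.Finite := by
  have key : ∀ i, {t : Eu d |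
      t ∈ M.lattice ∧ (M.tile (i, t) ∩ Metric.closedBall 0 R).Nonempty}.Finite := by
    intro i
    -- Packing argument: translates of one element that meet the ball have disjoint interiors of
    -- equal positive volume, all inside the ball of radius `R + 2 * D`, because two points of the
    -- same translate differ by at most `2 * D`.
    obtain ⟨D, hD⟩ := (M.isCompact_elem i).isBounded.exists_norm_le
    let A := {t : Eu d | t ∈ M.lattice ∧ (M.tile (i, t) ∩ Metric.closedBall 0 R).Nonempty}
    have hvol : ∀ t : Eu d, volume (interior (M.tile (i, t))) = volume (interior (M.elem i)) := by
      intro t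
      rw [interior_tile]
      have := measure_preimage_add_right (volume : Measure (Eu d)) (-t) (interior (M.elem i))
      simpa only [sub_eq_add_neg] using! this
    have hpos : 0 < volume (interior (M.elem i)) :=
      isOpen_interior.measure_pos _ (M.interior_elem_nonempty i)
    have hfin := Measure.finite_const_le_meas_of_disjoint_iUnion (volume : Measure (Eu d)) hpos
      (As := fun t : A => interior (M.tile (i, t)))
      (fun _ => isOpen_interior.measurableSet)
      (fun t t' htt' => M.disjoint_interior_tile t.2.1 t'.2.1
        fun h => htt' (Subtype.ext (Prod.ext_iff.1 h).2)) (by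
        refine ((measure_mono (t := Metric.closedBall (0 : Eu d) (R + 2 * D)) ?_).trans_lt
          measure_closedBall_lt_top).ne
        refine Set.iUnion_subset fun t x hx => ?_
        obtain ⟨-, y, hy, hyR⟩ := t.2
        have hx' : x ∈ M.tile (i, (t : Eu d)) := interior_subset hx
        have h1 := hD _ hx'
        have h2 := hD _ hy
        rw [mem_closedBall_zero_iff] at hyR ⊢
        have h3 : x = (x - (t : Eu d)) - (y - (t : Eu d)) + y := by abel
        rw [h3]
        calc _ ≤ ‖x - (t : Eu d)‖ + ‖y - (t : Eu d)‖ + ‖y‖ :=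
              (norm_add_le _ _).trans (by gcongr; exact norm_sub_le _ _)
          _ ≤ _ := by simp only at h1 h2; linarith)
    simp only [hvol, le_refl, Set.ofPred_true] at hfin
    have hA : Finite A := Set.finite_univ_iff.1 hfin
    exact A.toFinite
  refine (Set.finite_iUnion fun i => (key i).image (Prod.mk i)).subset ?_
  rintro ⟨i, t⟩ h
  exact Set.mem_iUnion.2 ⟨i, t, h, rfl⟩

/-- Every tile meets some ball of integer radius. Countability allows an almost-everywhere condition
to be imposed on all tiles at once. -/
lemma countable_tiles : {a : Fin M.numElem × Eu d | a.2 ∈ M.lattice}.Countable := by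
  refine (Set.countable_iUnion fun N : ℕ => (M.finite_tiles N).countable).mono fun a ha => ?_
  obtain ⟨x, hx⟩ := M.interior_tile_nonempty a
  obtain ⟨N, hN⟩ := exists_nat_ge ‖x‖
  exact Set.mem_iUnion.2 ⟨N, ha, x, interior_subset hx, by simpa using hN⟩

/-- A point at which a ray leaves an element belongs to another translated element. -/
lemma exists_tile_of_exit {i : Fin M.numElem} {y w : Eu d}
    (hw : ∀ ε : ℝ, 0 < ε → y + ε • w ∉ M.elem i) :
    ∃ a, a.2 ∈ M.lattice ∧ a ≠ (i, 0) ∧ y ∈ M.tile a := by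
  -- For `0 < ε < 1` the points `y + ε • w` stay in this ball. They are covered by finitely many
  -- closed tiles other than the element itself, so the limit `y` is covered by them too.
  have hfin := (M.finite_tiles (‖y‖ + ‖w‖)).subset
    (Set.sdiff_subset (t := {((i, 0) : Fin M.numElem × Eu d)}))
  have hcl := hfin.isClosed_biUnion fun a _ => M.isClosed_tile a
  have hlim : Filter.Tendsto (fun ε : ℝ => y + ε • w) (nhdsWithin 0 (Set.Ioi 0)) (nhds y) := by
    have : Continuous fun ε : ℝ => y + ε • w := by fun_prop
    simpa using (this.tendsto 0).mono_left nhdsWithin_le_nhds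
  have hmem := hcl.mem_of_tendsto hlim (by
    filter_upwards [Ioo_mem_nhdsGT (zero_lt_one (α := ℝ))] with ε hε
    obtain ⟨j, t, ht, hj⟩ := M.cover (y + ε • w)
    refine Set.mem_biUnion (x := (j, t)) ⟨⟨ht, _, hj, ?_⟩, ?_⟩ hj
    · rw [mem_closedBall_zero_iff]
      refine (norm_add_le _ _).trans ?_
      rw [norm_smul, Real.norm_of_nonneg hε.1.le]
      nlinarith [norm_nonneg w, hε.2]
    · intro h
      obtain ⟨h1, h2⟩ := Prod.ext_iff.1 (Set.mem_singleton_iff.1 h)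
      simp only at h1 h2
      subst h1 h2
      refine hw ε hε.1 ?_
      simpa [elem] using hj)
  obtain ⟨a, ha, hy⟩ := Set.mem_iUnion₂.1 hmem
  exact ⟨a, ha.1.1, ha.2, hy⟩

end Tiling

/-! ### Rays leaving an element -/

/-- The segment from a point of a convex set to an interior point is interior, except possibly at
its start. -/
lemma eventually_mem_interior_of_ray {d : ℕ} {A : Set (Eu d)} (hA : Convex ℝ A) {y w : Eu d}
    (hy : y ∈ A) {r : ℝ} (hr : 0 ≤ r) (h : y + r • w ∈ interior A) :
    ∀ᶠ ε : ℝ in nhdsWithin 0 (Set.Ioi 0), y + ε • w ∈ interior A := by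
  rcases hr.eq_or_lt with rfl | hr
  · have hc : Continuous fun ε : ℝ => y + ε • w := by fun_prop
    exact (hc.tendsto 0).mono_left nhdsWithin_le_nhds (isOpen_interior.mem_nhds h)
  · filter_upwards [Ioo_mem_nhdsGT hr] with ε hε
    have := hA.add_smul_sub_mem_interior hy h (t := ε / r)
      ⟨div_pos hε.1 hr, (div_le_one hr).2 hε.2.le⟩
    rwa [add_sub_cancel_left, smul_smul, div_mul_cancel₀ _ hr.ne'] at this

/-- On a line that meets the interiors of the tiles involved, a ray that leaves an element enters at
most one other tile. -/
lemma tile_unique_of_exit {d : ℕ} (M : PeriodicMesh d) {i : Fin M.numElem} {y w : Eu d}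
    (hy : y ∈ M.elem i) (hw : ∀ ε : ℝ, 0 < ε → y + ε • w ∉ M.elem i)
    (hl : ∀ a : Fin M.numElem × Eu d, a.2 ∈ M.lattice → y ∈ M.tile a →
      ∃ r : ℝ, y + r • w ∈ interior (M.tile a))
    {a b : Fin M.numElem × Eu d} (ha : a.2 ∈ M.lattice) (hb : b.2 ∈ M.lattice)
    (hai : a ≠ (i, 0)) (hbi : b ≠ (i, 0)) (hya : y ∈ M.tile a) (hyb : y ∈ M.tile b) : a = b := by
  have hi : ∀ᶠ ε : ℝ in nhdsWithin 0 (Set.Ioi 0), y + ε • (-w) ∈ interior (M.elem i) := by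
    obtain ⟨r, hr⟩ := hl (i, 0) (zero_mem _) (by rwa [tile_zero])
    rw [tile_zero] at hr
    have hr0 : r ≤ 0 := by
      by_contra! h
      exact hw r h (interior_subset hr)
    exact eventually_mem_interior_of_ray (M.convex_elem i) hy (neg_nonneg.2 hr0) (by simpa)
  have key : ∀ a : Fin M.numElem × Eu d, a.2 ∈ M.lattice → a ≠ (i, 0) → y ∈ M.tile a →
      ∀ᶠ ε : ℝ in nhdsWithin 0 (Set.Ioi 0), y + ε • w ∈ interior (M.tile a) := by
    intro a ha hai hya
    obtain ⟨r, hr⟩ := hl a ha hya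
    -- A tile whose interior is met behind `y` would overlap the element just behind `y`. So every
    -- other tile containing `y` has interior points of the ray just ahead of `y`, and two such
    -- tiles would overlap there.
    rcases le_or_gt 0 r with h | h
    · exact eventually_mem_interior_of_ray (M.convex_tile a) hya h hr
    · have hb := eventually_mem_interior_of_ray (M.convex_tile a) hya (w := -w)
        (neg_nonneg.2 h.le) (by simpa)
      obtain ⟨ε, h1, h2⟩ := (hi.and hb).exists
      rw [← tile_zero] at h1
      exact (Set.disjoint_left.1 (M.disjoint_interior_tile ha (zero_mem _) hai) h2 h1).elim
  by_contra hab
  obtain ⟨ε, h1, h2⟩ := ((key a ha hai hya).and (key b hb hbi hyb)).exists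
  exact Set.disjoint_left.1 (M.disjoint_interior_tile ha hb hab) h1 h2

/-! ### The two sides of a face -/

section Sides

variable {d : ℕ} (M : PeriodicMesh d)

/-- The element on a side of a face; `true` is the side of `T⁻`. -/
def owner (f : Fin M.numFace × Bool) : Fin M.numElem := cond f.2 (M.minus f.1) (M.plus f.1)

/-- The translated element that is seen from a side of a face. -/
def neighbour (f : Fin M.numFace × Bool) : Fin M.numElem × Eu d :=
  cond f.2 (M.plus f.1, M.shift f.1) (M.minus f.1, -M.shift f.1)

/-- The outer normal of the element on a side of a face. -/
def outerNormal (f : Fin M.numFace × Bool) : Eu d := cond f.2 (M.normal f.1) (-M.normal f.1)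

/-- The face, placed on the boundary of the element on the given side. -/
def piece (f : Fin M.numFace × Bool) : Set (Eu d) := M.elem (M.owner f) ∩ M.tile (M.neighbour f)

lemma piece_true (e : Fin M.numFace) : M.piece (e, true) = M.face e := rfl

lemma piece_false (e : Fin M.numFace) :
    M.piece (e, false) = (fun y => y + M.shift e) ⁻¹' M.face e := by
  ext y
  simp [piece, face, owner, neighbour, tile, and_comm]

lemma isCompact_piece (f : Fin M.numFace × Bool) : IsCompact (M.piece f) :=
  (M.isCompact_elem _).inter_right (M.isClosed_tile _)

lemma isCompact_face (e : Fin M.numFace) : IsCompact (M.face e) := M.isCompact_piece (e, true)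

lemma neighbour_mem_lattice (f : Fin M.numFace × Bool) : (M.neighbour f).2 ∈ M.lattice := by
  rcases f with ⟨e, _ | _⟩
  · exact neg_mem (M.shift_mem e)
  · exact M.shift_mem e

lemma neighbour_ne (f : Fin M.numFace × Bool) : M.neighbour f ≠ (M.owner f, 0) := by
  intro h
  obtain ⟨h1, h2⟩ := Prod.ext_iff.1 h
  rcases f with ⟨e, _ | _⟩
  · exact (M.face_ne e).elim (fun h' => h' h1) fun h' => h' (neg_eq_zero.1 h2)
  · exact (M.face_ne e).elim (fun h' => h' h1.symm) fun h' => h' h2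

lemma measure_piece_ne_zero (f : Fin M.numFace × Bool) :
    Measure.euclideanHausdorffMeasure (d - 1) (M.piece f) ≠ 0 := by
  rcases f with ⟨e, _ | _⟩
  · rw [piece_false, measure_preimage_add_right]
    exact M.face_measure e
  · exact M.face_measure e

lemma norm_outerNormal (f : Fin M.numFace × Bool) : ‖M.outerNormal f‖ = 1 := by
  rcases f with ⟨e, _ | _⟩ <;> simp [outerNormal, M.normal_norm]

lemma ne_or_ne_zero {i : Fin M.numElem} {a : Fin M.numElem × Eu d} (h : a ≠ (i, 0)) :
    i ≠ a.1 ∨ a.2 ≠ 0 := by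
  by_contra! hc
  exact h (Prod.ext hc.1.symm hc.2)

lemma exists_side {i : Fin M.numElem} {a : Fin M.numElem × Eu d} (ha : a.2 ∈ M.lattice)
    (hai : a ≠ (i, 0))
    (hm : Measure.euclideanHausdorffMeasure (d - 1) (M.elem i ∩ M.tile a) ≠ 0) :
    ∃ f, M.owner f = i ∧ M.neighbour f = a := by
  obtain ⟨e, h, -⟩ := M.face_unique i a.1 a.2 ha (M.ne_or_ne_zero hai) hm
  rcases h with ⟨h1, h2, h3⟩ | ⟨h1, h2, h3⟩
  · exact ⟨(e, true), h1, Prod.ext h2 h3⟩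
  · exact ⟨(e, false), h2, Prod.ext h1 (neg_eq_iff_eq_neg.2 h3)⟩

/-- `face_unique` determines the face up to orientation. The two sides of one face could agree only
if `minus = plus` and `shift = -shift`, that is `shift = 0`, which `face_ne` forbids. -/
lemma side_unique {f f' : Fin M.numFace × Bool} (ho : M.owner f = M.owner f')
    (hn : M.neighbour f = M.neighbour f') : f = f' := by
  obtain ⟨e₀, -, hu⟩ := M.face_unique (M.owner f) (M.neighbour f).1 (M.neighbour f).2
    (M.neighbour_mem_lattice f) (M.ne_or_ne_zero (M.neighbour_ne f)) (M.measure_piece_ne_zero f)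
  have key : ∀ g, M.owner g = M.owner f → M.neighbour g = M.neighbour f → g.1 = e₀ := by
    intro g h1 h2
    refine hu _ ?_
    rw [← h1, ← h2]
    rcases g with ⟨e, _ | _⟩
    · exact Or.inr ⟨rfl, rfl, (neg_neg _).symm⟩
    · exact Or.inl ⟨rfl, rfl, rfl⟩
  have he : f.1 = f'.1 := (key f rfl rfl).trans (key f' ho.symm hn.symm).symm
  obtain ⟨e, b⟩ := f
  obtain ⟨e', b'⟩ := f'
  obtain rfl : e = e' := he
  have hself : ∀ t : Eu d, t = -t → t = 0 := by
    intro t ht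
    have h2 : (2 : ℝ) • t = 0 := by rw [two_smul]; nth_rewrite 2 [ht]; exact add_neg_cancel t
    simpa using h2
  obtain ⟨hn1, hn2⟩ := Prod.ext_iff.1 hn
  rcases b with _ | _ <;> rcases b' with _ | _
  · rfl
  · exact ((M.face_ne e).elim (fun h => h ho.symm) fun h => h (hself _ hn2.symm)).elim
  · exact ((M.face_ne e).elim (fun h => h ho) fun h => h (hself _ hn2)).elim
  · rfl

/-- A piece lies in a supporting hyperplane of its element. -/
lemma exists_support (f : Fin M.numFace × Bool) : ∃ c : ℝ,
    (∀ y ∈ M.piece f, inner ℝ (M.outerNormal f) y = c) ∧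
      ∀ y ∈ M.elem (M.owner f), inner ℝ (M.outerNormal f) y ≤ c := by
  obtain ⟨z, hz⟩ := nonempty_of_measure_ne_zero (M.measure_piece_ne_zero f)
  have key : ∀ x ∈ M.elem (M.owner f), ∀ y ∈ M.tile (M.neighbour f),
      inner ℝ (M.outerNormal f) x ≤ inner ℝ (M.outerNormal f) y := by
    intro x hx y hy
    rcases f with ⟨e, _ | _⟩
    · have hy' : y + M.shift e ∈ M.elem (M.minus e) := by
        simpa [tile, neighbour] using hy
      have := M.normal_sep e _ hy' x hx
      simp only [outerNormal, cond_false, inner_neg_left, neg_le_neg_iff]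
      simp only [inner_add_right] at this
      linarith
    · have := M.normal_sep e x hx (y - M.shift e) hy
      simpa [outerNormal] using this
  refine ⟨inner ℝ (M.outerNormal f) z, fun y hy => ?_, fun y hy => key y hy z hz.2⟩
  exact le_antisymm (key y hy.1 z hz.2) (key z hz.1 y hy.2)

end Sides

/-! ### The divergence theorem on a periodic mesh -/

section Divergence

variable {k : ℕ} (M : PeriodicMesh (k + 1))

/-- In an isometric chart of its hyperplane the face becomes a compact subset of `ℝ^k`. -/
lemma measure_face_lt_top (e : Fin M.numFace) :
    Measure.euclideanHausdorffMeasure k (M.face e) < ⊤ := by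
  obtain ⟨c, hc, -⟩ := M.exists_support (e, true)
  obtain ⟨φ, -, -, hφ, hr, -, -⟩ := exists_isometry_hyperplane 0 (M.norm_outerNormal (e, true)) c
  have hsub : M.face e ⊆ Set.range φ := fun y hy => (hr y).1 (hc y hy)
  have h := hφ.euclideanHausdorffMeasure_preimage (d := k) (M.face e)
  rw [Set.inter_eq_self_of_subset_left hsub,
    EuclideanSpace.euclideanHausdorffMeasure_eq_volume] at h
  rw [← h]
  exact (hφ.isClosedEmbedding.isCompact_preimage (M.isCompact_face e)).measure_lt_top

lemma integrableOn_face (e : Fin M.numFace) {g : Eu (k + 1) → ℝ} (hg : Continuous g) :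
    IntegrableOn g (M.face e) (Measure.euclideanHausdorffMeasure k) := by
  obtain ⟨C, hC⟩ := (M.isCompact_face e).exists_bound_of_continuousOn hg.continuousOn
  exact Measure.integrableOn_of_bounded (M.measure_face_lt_top e).ne
    hg.aestronglyMeasurable
    ((ae_restrict_iff' (M.isCompact_face e).measurableSet).2 (Filter.Eventually.of_forall hC))

lemma integral_piece_false (e : Fin M.numFace) (g : Eu (k + 1) → ℝ) :
    ∫ y in M.piece (e, false), g y ∂(Measure.euclideanHausdorffMeasure k)
      = ∫ y in M.face e, g (y - M.shift e) ∂(Measure.euclideanHausdorffMeasure k) := by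
  have hmp := measurePreserving_add_right
    (Measure.euclideanHausdorffMeasure k : Measure (Eu (k + 1))) (M.shift e)
  have he : MeasurableEmbedding fun y : Eu (k + 1) => y + M.shift e :=
    (Homeomorph.addRight (M.shift e)).measurableEmbedding
  have h := hmp.setIntegral_preimage_emb he (fun y => g (y - M.shift e)) (M.face e)
  simp only [add_sub_cancel_right] at h
  rw [piece_false, h]

/-- On almost every line, a ray leaves an element through exactly one piece of its boundary. -/
lemma ae_existsUnique_piece (s : Fin (k + 1)) (i : Fin M.numElem) :
    ∀ᵐ x : Eu k, ∀ y ∈ M.elem i, proj s y = x → ∀ σ : ℝ, σ ≠ 0 →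
      (∀ ε : ℝ, 0 < ε → y + ε • EuclideanSpace.single s σ ∉ M.elem i) →
        ∃! f : {f // M.owner f = i}, y ∈ M.piece f := by
  have h1 : ∀ᵐ x : Eu k, ∀ a ∈ {a : Fin M.numElem × Eu (k + 1) | a.2 ∈ M.lattice},
      x ∈ proj s '' M.tile a → x ∈ proj s '' interior (M.tile a) :=
    (ae_ball_iff M.countable_tiles).2 fun a _ =>
      ae_mem_proj_interior s (M.convex_tile a) (M.interior_tile_nonempty a)
  have h2 : ∀ᵐ x : Eu k, ∀ a ∈ {a : Fin M.numElem × Eu (k + 1) | a.2 ∈ M.lattice},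
      x ∈ proj s '' (M.elem i ∩ M.tile a) →
        Measure.euclideanHausdorffMeasure k (M.elem i ∩ M.tile a) ≠ 0 := by
    refine (ae_ball_iff M.countable_tiles).2 fun a _ => ?_
    -- Contacts of zero surface measure, such as corners and lower-dimensional edges, project to
    -- null sets because the projection is 1-Lipschitz; almost every line avoids them.
    by_cases h0 : Measure.euclideanHausdorffMeasure k (M.elem i ∩ M.tile a) = 0
    · have hnull : volume (proj s '' (M.elem i ∩ M.tile a)) = 0 := by
        rw [← EuclideanSpace.euclideanHausdorffMeasure_eq_volume]
        rw [Measure.euclideanHausdorffMeasure_def, Measure.smul_apply, smul_eq_zero] at h0 ⊢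
        refine h0.imp_right fun h0 => le_antisymm ?_ bot_le
        have := (lipschitz_proj s).hausdorffMeasure_image_le (d := k) (Nat.cast_nonneg k)
          (M.elem i ∩ M.tile a)
        simpa [h0] using this
      filter_upwards [measure_eq_zero_iff_ae_notMem.1 hnull] with x hx hx'
      exact (hx hx').elim
    · exact Filter.Eventually.of_forall fun _ _ => h0
  filter_upwards [h1, h2] with x hx1 hx2 y hy hyx σ hσ hw
  have hl : ∀ a : Fin M.numElem × Eu (k + 1), a.2 ∈ M.lattice → y ∈ M.tile a →
      ∃ r : ℝ, y + r • EuclideanSpace.single s σ ∈ interior (M.tile a) := by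
    intro a ha hya
    obtain ⟨z, hz, hzx⟩ := hx1 a ha ⟨y, hya, hyx⟩
    refine ⟨(z s - y s) / σ, ?_⟩
    have : y + ((z s - y s) / σ) • EuclideanSpace.single s σ = z := by
      apply eq_of_proj_eq s
      · simp [hyx, hzx]
      · simp [div_mul_cancel₀ _ hσ]
    rwa [this]
  obtain ⟨a, ha, hai, hya⟩ := M.exists_tile_of_exit hw
  obtain ⟨f, hf, hfa⟩ := M.exists_side ha hai (hx2 a ha ⟨y, ⟨hy, hya⟩, hyx⟩)
  refine ⟨⟨f, hf⟩, ⟨by rwa [hf], by rwa [hfa]⟩, ?_⟩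
  rintro ⟨f', hf'⟩ hyf'
  refine Subtype.ext (M.side_unique (hf'.trans hf.symm) ?_)
  rw [hfa]
  refine M.tile_unique_of_exit hy hw hl (M.neighbour_mem_lattice f') ha ?_ hai hyf'.2 hya
  exact fun h => M.neighbour_ne f' (by rw [hf']; exact h)

/-- The divergence theorem on an element. -/
lemma setIntegral_elem_fderiv (s : Fin (k + 1)) (i : Fin M.numElem) {g : Eu (k + 1) → ℝ}
    (hg : ContDiff ℝ 1 g) :
    ∫ y in M.elem i, fderiv ℝ g y (EuclideanSpace.single s 1)
      = ∑ f : {f // M.owner f = i}, M.outerNormal f s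
          * ∫ y in M.piece f, g y ∂(Measure.euclideanHausdorffMeasure k) := by
  choose c hc hc' using M.exists_support
  refine setIntegral_fderiv_eq_sum_pieces s (M.isCompact_elem i) (M.convex_elem i)
    (M.interior_elem_nonempty i) (P := fun f : {f // M.owner f = i} => M.piece f)
    (n := fun f => M.outerNormal f) (c := fun f => c f) (fun f => M.isCompact_piece f) ?_
    (fun f => M.norm_outerNormal f) (fun f => hc f) ?_ (M.ae_existsUnique_piece s i) hg
  · rintro ⟨f, rfl⟩ y hy
    exact hy.1
  · rintro ⟨f, rfl⟩ y hy
    exact hc' f y hy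

/-- Piecewise continuously differentiable functions. -/
def IsC1 {d : ℕ} {M : PeriodicMesh d} (G : M.Fn) : Prop := ∀ i, ContDiff ℝ 1 (G i)

/-- The divergence theorem for piecewise smooth functions on the periodic domain. -/
theorem integral_pd_eq_sum_jump (s : Fin (k + 1)) {G : M.Fn} (hG : IsC1 G) :
    M.integral (M.pd s G) = ∑ e, M.faceIntegral e fun y => M.normal e s * M.jump e G y := by
  have h1 : ∀ i, ∫ x in M.elem i, M.pd s G i x
      = ∑ f : {f // M.owner f = i}, M.outerNormal f s
          * ∫ y in M.piece f, G (M.owner f) y ∂(Measure.euclideanHausdorffMeasure k) := by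
    intro i
    refine (M.setIntegral_elem_fderiv s i (hG i)).trans (Finset.sum_congr rfl fun f _ => ?_)
    rw [f.2]
  unfold integral
  simp_rw [h1]
  -- Summing over elements and then over their sides counts each face twice, with opposite normals;
  -- after translation the two traces form the jump.
  rw [Fintype.sum_fiberwise M.owner fun f => M.outerNormal f s
    * ∫ y in M.piece f, G (M.owner f) y ∂(Measure.euclideanHausdorffMeasure k),
    Fintype.sum_prod_type]
  refine Finset.sum_congr rfl fun e _ => ?_
  rw [Fintype.sum_bool, integral_piece_false, piece_true]
  have hplus : Continuous fun y => G (M.plus e) (y - M.shift e) :=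
    (hG _).continuous.comp (by fun_prop)
  change M.normal e s * (∫ y in M.face e, G (M.minus e) y ∂(Measure.euclideanHausdorffMeasure k))
      + (-M.normal e) s * (∫ y in M.face e, G (M.plus e) (y - M.shift e)
          ∂(Measure.euclideanHausdorffMeasure k))
    = ∫ y in M.face e, M.normal e s * (G (M.minus e) y - G (M.plus e) (y - M.shift e))
        ∂(Measure.euclideanHausdorffMeasure k)
  rw [integral_const_mul, integral_sub (M.integrableOn_face e (hG _).continuous)
    (M.integrableOn_face e hplus)]
  simp
  ring

end Divergence

/-! ### Calculus of piecewise functions -/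

section Calculus

variable {d : ℕ} {M : PeriodicMesh d}

/-- Piecewise continuous functions. -/
def IsC0 (G : M.Fn) : Prop := ∀ i, Continuous (G i)

lemma IsC1.isC0 {G : M.Fn} (hG : IsC1 G) : IsC0 G := fun i => (hG i).continuous

lemma IsC1.pd {G : M.Fn} (hG : IsC1 G) (s : Fin d) : IsC0 (M.pd s G) := fun i => by
  have := (hG i).continuous_fderiv one_ne_zero
  exact this.clm_apply continuous_const

lemma IsC1.mul {G H : M.Fn} (hG : IsC1 G) (hH : IsC1 H) : IsC1 (G * H) :=
  fun i => (hG i).mul (hH i)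

lemma isC1_one : IsC1 (fun _ _ => 1 : M.Fn) := fun _ => contDiff_const

lemma IsC1.sum {ι : Type*} [Fintype ι] {G : ι → M.Fn} (hG : ∀ l, IsC1 (G l)) (c : ι → ℝ) :
    IsC1 (∑ l, c l • G l) := by
  intro i
  have : (∑ l, c l • G l) i = fun x => ∑ l, c l * G l i x := by
    funext x; simp [Finset.sum_apply]
  rw [this]
  exact ContDiff.sum fun l _ => contDiff_const.mul (hG l i)

lemma isC1_of_mem_dg {p : ℕ} {G : M.Fn} (hG : G ∈ M.dg p) : IsC1 G := by
  intro i
  obtain ⟨P, -, hP⟩ := hG i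
  rw [funext hP]
  clear hP
  induction P using MvPolynomial.induction_on with
  | C a => simpa using contDiff_const
  | add P Q hP hQ => simpa using hP.add hQ
  | mul_X P j hP =>
    simp only [map_mul, MvPolynomial.eval_X]
    exact hP.mul (by fun_prop)

lemma isC1_wmul {G : M.Fn} (hG : IsC1 G) : IsC1 (wmul G) := fun i => by
  refine ContDiff.mul ?_ (hG i)
  exact Real.contDiff_exp.comp ((contDiff_norm_sq ℝ).neg.div_const 2)

/-- Integrability on all elements. -/
def IsInt (G : M.Fn) : Prop := ∀ i, IntegrableOn (G i) (M.elem i)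

lemma IsC0.isInt {G : M.Fn} (hG : IsC0 G) : IsInt G :=
  fun i => (hG i).continuousOn.integrableOn_compact (M.isCompact_elem i)

lemma IsC0.mul {G H : M.Fn} (hG : IsC0 G) (hH : IsC0 H) : IsC0 (G * H) :=
  fun i => (hG i).mul (hH i)

lemma IsInt.mul_isC0 {G H : M.Fn} (hG : IsInt G) (hH : IsC0 H) : IsInt (G * H) :=
  fun i => (hG i).mul_continuousOn (hH i).continuousOn (M.isCompact_elem i)

lemma integral_sum {ι : Type*} [Fintype ι] {G : ι → M.Fn} (hG : ∀ l, IsInt (G l)) (c : ι → ℝ) :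
    M.integral (∑ l, c l • G l) = ∑ l, c l * M.integral (G l) := by
  unfold integral
  simp_rw [Finset.mul_sum]
  rw [Finset.sum_comm]
  refine Finset.sum_congr rfl fun i _ => ?_
  simp_rw [← MeasureTheory.integral_const_mul]
  rw [← integral_finsetSum _ fun l _ => (hG l i).const_mul (c l)]
  simp [Finset.sum_apply]

lemma integral_add {G H : M.Fn} (hG : IsInt G) (hH : IsInt H) :
    M.integral (G + H) = M.integral G + M.integral H := by
  unfold integral
  rw [← Finset.sum_add_distrib]
  exact Finset.sum_congr rfl fun i _ => MeasureTheory.integral_add (hG i) (hH i)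

lemma integral_smul (c : ℝ) (G : M.Fn) : M.integral (c • G) = c * M.integral G := by
  simp [integral, Finset.mul_sum, MeasureTheory.integral_const_mul]

lemma ip_eq (G H : M.Fn) : M.ip G H = M.integral (G * H) := rfl

lemma ip_comm (G H : M.Fn) : M.ip G H = M.ip H G := by
  unfold ip
  congr 1
  funext i x
  ring

lemma ip_sum_left {ι : Type*} [Fintype ι] {G : ι → M.Fn} (hG : ∀ l, IsInt (G l)) (c : ι → ℝ)
    {H : M.Fn} (hH : IsC0 H) : M.ip (∑ l, c l • G l) H = ∑ l, c l * M.ip (G l) H := by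
  have h := integral_sum (fun l => (hG l).mul_isC0 hH) c
  refine Eq.trans ?_ h
  unfold ip
  congr 1
  funext i x
  simp [Finset.sum_apply, Finset.sum_mul, mul_assoc]

lemma ip_sum_right {ι : Type*} [Fintype ι] {G : ι → M.Fn} (hG : ∀ l, IsInt (G l)) (c : ι → ℝ)
    {H : M.Fn} (hH : IsC0 H) : M.ip H (∑ l, c l • G l) = ∑ l, c l * M.ip H (G l) := by
  simp_rw [ip_comm H]
  exact ip_sum_left hG c hH

lemma ip_sub_left {G G' H : M.Fn} (hG : IsC0 G) (hG' : IsC0 G') (hH : IsC0 H) :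
    M.ip (G - G') H = M.ip G H - M.ip G' H := by
  have h := ip_sum_left (G := ![G, G']) (by
    intro l; fin_cases l
    · exact hG.isInt
    · exact hG'.isInt) ![1, -1] hH
  simpa [Fin.sum_univ_two, sub_eq_add_neg] using h

lemma pd_sum {ι : Type*} [Fintype ι] {G : ι → M.Fn} (hG : ∀ l, IsC1 (G l)) (c : ι → ℝ)
    (s : Fin d) : M.pd s (∑ l, c l • G l) = ∑ l, c l • M.pd s (G l) := by
  funext i x
  have : (∑ l, c l • G l) i = fun x => ∑ l, c l * G l i x := by
    funext x; simp [Finset.sum_apply]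
  unfold pd
  rw [this, fderiv_fun_sum fun l _ => ((hG l i).differentiable one_ne_zero x).const_mul _]
  simp only [Finset.sum_apply, Pi.smul_apply, _root_.sum_apply, smul_eq_mul]
  refine Finset.sum_congr rfl fun l _ => ?_
  rw [fderiv_const_mul ((hG l i).differentiable one_ne_zero x)]
  simp

lemma pd_mul {G H : M.Fn} (hG : IsC1 G) (hH : IsC1 H) (s : Fin d) :
    M.pd s (G * H) = M.pd s G * H + G * M.pd s H := by
  funext i x
  have : (G * H) i = fun x => G i x * H i x := rfl
  unfold pd
  rw [this, fderiv_fun_mul ((hG i).differentiable one_ne_zero x)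
    ((hH i).differentiable one_ne_zero x)]
  simp
  ring

lemma pd_one (s : Fin d) : M.pd s (fun _ _ => 1) = 0 := by
  funext i x
  simp [pd]

lemma pd_zero (s : Fin d) : M.pd s 0 = 0 := by
  funext i x
  simp [pd]

lemma jump_one (e : Fin M.numFace) : M.jump e (fun _ _ => 1) = 0 := by
  funext y
  simp [jump, traceMinus, tracePlus]

lemma IsC0.continuous_jump {G : M.Fn} (hG : IsC0 G) (e : Fin M.numFace) :
    Continuous (M.jump e G) := by
  have h1 := hG (M.minus e)
  have h2 := hG (M.plus e)
  unfold jump traceMinus tracePlus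
  fun_prop

lemma IsC0.continuous_avg {G : M.Fn} (hG : IsC0 G) (e : Fin M.numFace) :
    Continuous (M.avg e G) := by
  have h1 := hG (M.minus e)
  have h2 := hG (M.plus e)
  unfold avg traceMinus tracePlus
  fun_prop

lemma jump_sum {ι : Type*} [Fintype ι] (G : ι → M.Fn) (c : ι → ℝ) (e : Fin M.numFace)
    (y : Eu d) : M.jump e (∑ l, c l • G l) y = ∑ l, c l * M.jump e (G l) y := by
  simp [jump, traceMinus, tracePlus, Finset.sum_apply, mul_sub, Finset.sum_sub_distrib]

lemma avg_sum {ι : Type*} [Fintype ι] (G : ι → M.Fn) (c : ι → ℝ) (e : Fin M.numFace)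
    (y : Eu d) : M.avg e (∑ l, c l • G l) y = ∑ l, c l * M.avg e (G l) y := by
  simp only [avg, traceMinus, tracePlus, Finset.sum_apply, Pi.smul_apply, smul_eq_mul,
    ← Finset.sum_add_distrib, Finset.mul_sum]
  exact Finset.sum_congr rfl fun _ _ => by ring

end Calculus

/-! ### Discrete integration by parts and the Euler form -/

section DiscreteDerivative

variable {k : ℕ} {M : PeriodicMesh (k + 1)}

lemma faceIntegral_sum {ι : Type*} [Fintype ι] (e : Fin M.numFace) {g : ι → Eu (k + 1) → ℝ}
    (hg : ∀ l, Continuous (g l)) :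
    (M.faceIntegral e fun y => ∑ l, g l y) = ∑ l, M.faceIntegral e (g l) :=
  integral_finsetSum _ fun l _ => M.integrableOn_face e (hg l)

lemma faceIntegral_add (e : Fin M.numFace) {g h : Eu (k + 1) → ℝ}
    (hg : Continuous g) (hh : Continuous h) :
    (M.faceIntegral e fun y => g y + h y) = M.faceIntegral e g + M.faceIntegral e h :=
  MeasureTheory.integral_add (M.integrableOn_face e hg) (M.integrableOn_face e hh)

lemma faceIntegral_const_mul {d : ℕ} {M : PeriodicMesh d} (e : Fin M.numFace) (c : ℝ)
    (g : Eu d → ℝ) : (M.faceIntegral e fun y => c * g y) = c * M.faceIntegral e g :=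
  MeasureTheory.integral_const_mul _ _

/-- Discrete integration by parts. -/
theorem discDeriv_eq_weak (s : Fin (k + 1)) {G H : M.Fn} (hG : IsC1 G) (hH : IsC1 H) :
    M.discDeriv s G H = -M.ip G (M.pd s H)
      + ∑ e, M.faceIntegral e fun y => M.normal e s * M.avg e G y * M.jump e H y := by
  have h := M.integral_pd_eq_sum_jump s (hG.mul hH)
  rw [pd_mul hG hH, integral_add ((hG.pd s).mul hH.isC0).isInt (hG.isC0.mul (hH.pd s)).isInt] at h
  -- The product rule for jumps: `[GH] = [G]{H} + {G}[H]`.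
  have h2 : ∀ e, (M.faceIntegral e fun y => M.normal e s * M.jump e (G * H) y)
      = (M.faceIntegral e fun y => M.normal e s * M.jump e G y * M.avg e H y)
        + M.faceIntegral e fun y => M.normal e s * M.avg e G y * M.jump e H y := by
    intro e
    rw [← faceIntegral_add]
    · congr 1
      funext y
      simp only [jump, avg, traceMinus, tracePlus, Pi.mul_apply]
      ring
    · exact (continuous_const.mul (hG.isC0.continuous_jump e)).mul (hH.isC0.continuous_avg e)
    · exact (continuous_const.mul (hG.isC0.continuous_avg e)).mul (hH.isC0.continuous_jump e)
  simp_rw [h2, Finset.sum_add_distrib] at h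
  change M.ip (M.pd s G) H + M.ip G (M.pd s H) = _ at h
  unfold discDeriv
  linarith

/-- The constant function has neither derivative nor jump, so the weak form vanishes. This is why
the electric force creates no mass. -/
lemma discDeriv_one_right (s : Fin (k + 1)) {G : M.Fn} (hG : IsC1 G) :
    M.discDeriv s G (fun _ _ => 1) = 0 := by
  rw [discDeriv_eq_weak s hG isC1_one, pd_one]
  simp [jump_one, faceIntegral, ip, integral]

lemma discDeriv_sum_left {ι : Type*} [Fintype ι] (s : Fin (k + 1)) {G : ι → M.Fn}
    (hG : ∀ l, IsC1 (G l)) (c : ι → ℝ) {H : M.Fn} (hH : IsC1 H) :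
    M.discDeriv s (∑ l, c l • G l) H = ∑ l, c l * M.discDeriv s (G l) H := by
  unfold discDeriv
  rw [pd_sum hG, ip_sum_left (fun l => ((hG l).pd s).isInt) c hH.isC0]
  simp_rw [mul_sub, Finset.sum_sub_distrib, Finset.mul_sum]
  congr 1
  rw [Finset.sum_comm]
  refine Finset.sum_congr rfl fun e _ => ?_
  simp_rw [← faceIntegral_const_mul]
  rw [← faceIntegral_sum]
  · congr 1
    funext y
    rw [jump_sum, Finset.mul_sum, Finset.sum_mul]
    exact Finset.sum_congr rfl fun _ _ => by ring
  · exact fun l => continuous_const.mul ((continuous_const.mul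
      ((hG l).isC0.continuous_jump e)).mul (hH.isC0.continuous_avg e))

lemma discDeriv_sum_right {ι : Type*} [Fintype ι] (s : Fin (k + 1)) {G : ι → M.Fn}
    (hG : ∀ l, IsC1 (G l)) (c : ι → ℝ) {H : M.Fn} (hH : IsC1 H) :
    M.discDeriv s H (∑ l, c l • G l) = ∑ l, c l * M.discDeriv s H (G l) := by
  unfold discDeriv
  rw [ip_sum_right (fun l => (hG l).isC0.isInt) c (hH.pd s)]
  simp_rw [mul_sub, Finset.sum_sub_distrib, Finset.mul_sum]
  congr 1
  rw [Finset.sum_comm]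
  refine Finset.sum_congr rfl fun e _ => ?_
  simp_rw [← faceIntegral_const_mul]
  rw [← faceIntegral_sum]
  · congr 1
    funext y
    rw [avg_sum, Finset.mul_sum]
    exact Finset.sum_congr rfl fun _ _ => by ring
  · exact fun l => continuous_const.mul ((continuous_const.mul
      (hH.isC0.continuous_jump e)).mul ((hG l).isC0.continuous_avg e))

/-- The weak form of the discrete divergence with central fluxes. -/
lemma weak_divergence_eq {Y : Fin (k + 1) → M.Fn} (hY : ∀ s, IsC1 (Y s)) {H : M.Fn}
    (hH : IsC1 H) :
    -(∑ s, M.ip (Y s) (M.pd s H)) + (∑ e, M.faceIntegral e fun y =>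
        (∑ s, M.normal e s * M.avg e (Y s) y) * M.jump e H y)
      = ∑ s, M.discDeriv s (Y s) H := by
  simp_rw [fun s => discDeriv_eq_weak s (hY s) hH, Finset.sum_add_distrib, Finset.sum_neg_distrib]
  congr 1
  rw [Finset.sum_comm]
  refine Finset.sum_congr rfl fun e _ => ?_
  rw [← faceIntegral_sum]
  · simp_rw [Finset.sum_mul]
  · exact fun s => (continuous_const.mul ((hY s).isC0.continuous_avg e)).mul
      (hH.isC0.continuous_jump e)

/-- One component of the explicit Euler scheme, in terms of discrete derivatives. -/
lemma eulerForm_single {ι : Type} [Fintype ι] [DecidableEq ι] (τ : ℝ)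
    (A B : Fin (k + 1) → Matrix ι ι ℝ) {c : Fin (k + 1) → Eu (k + 1) → ℝ}
    (hc : ∀ s T, IntegrableOn (c s) (M.elem T)) {U U' : ι → M.Fn} (hU : ∀ l, IsC1 (U l))
    (hU' : ∀ l, IsC1 (U' l)) {H : M.Fn} (hH : IsC1 H) (a : ι) :
    M.eulerForm τ A B c U U' (Pi.single a H)
      = 1 / τ * (M.ip (U' a) H - M.ip (U a) H) + ∑ s, M.discDeriv s (∑ l, A s a l • U l) H
        + ∑ s, ∑ l, B s a l * M.ip (fun T x => c s x * U l T x) H := by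
  have hY : ∀ s, IsC1 (∑ l, A s a l • U l) := fun s => IsC1.sum hU _
  -- The coefficient `c` is only integrable, so these products are treated as integrable rather than
  -- continuous.
  have hZ : ∀ s l, IsInt (fun T x => c s x * U l T x : M.Fn) := fun s l =>
    (show IsInt (fun _ x => c s x : M.Fn) from hc s).mul_isC0 (hU l).isC0
  have hval : ∀ (s : Fin (k + 1)) (b : ι) (T : Fin M.numElem) (y : Eu (k + 1)),
      M.pd s (Pi.single (M := fun _ => M.Fn) a H b) T y
        = if b = a then M.pd s H T y else 0 := by
    intro s b T y
    split_ifs with h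
    · subst h; rw [Pi.single_eq_same]
    · rw [Pi.single_eq_of_ne h, pd_zero]; rfl
  have hval' : ∀ (b : ι) (T : Fin M.numElem) (y : Eu (k + 1)),
      (Pi.single (M := fun _ => M.Fn) a H b) T y = if b = a then H T y else 0 := by
    intro b T y
    split_ifs with h
    · subst h; rw [Pi.single_eq_same]
    · rw [Pi.single_eq_of_ne h]; rfl
  have hval'' : ∀ (e : Fin M.numFace) (b : ι) (y : Eu (k + 1)),
      M.jump e (Pi.single (M := fun _ => M.Fn) a H b) y
        = if b = a then M.jump e H y else 0 := by
    intro e b y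
    split_ifs with h
    · subst h; rw [Pi.single_eq_same]
    · rw [Pi.single_eq_of_ne h]; simp [jump, traceMinus, tracePlus]
  have hvol : (fun T y => ∑ b, (1 / τ) * (U' b T y - U b T y)
          * (Pi.single (M := fun _ => M.Fn) a H b) T y
        + ∑ s, (-(∑ b, (∑ l, A s b l * U l T y)
              * M.pd s (Pi.single (M := fun _ => M.Fn) a H b) T y)
          + ∑ b, c s y * (∑ l, B s b l * U l T y)
              * (Pi.single (M := fun _ => M.Fn) a H b) T y) : M.Fn)
      = (1 / τ) • ((U' a - U a) * H) + (∑ s, (-1 : ℝ) • ((∑ l, A s a l • U l) * M.pd s H)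
        + ∑ s, (1 : ℝ) • ((∑ l, B s a l • (fun T x => c s x * U l T x : M.Fn)) * H)) := by
    funext T y
    simp only [hval, hval', mul_ite, mul_zero, Finset.sum_ite_eq', Finset.mem_univ, if_true,
      Pi.add_apply, Pi.smul_apply, Pi.mul_apply, Pi.sub_apply, Finset.sum_apply, smul_eq_mul,
      Finset.sum_add_distrib, one_mul, neg_mul, mul_assoc]
    congr 3
    funext s
    rw [Finset.sum_mul, Finset.sum_mul, Finset.mul_sum]
    exact Finset.sum_congr rfl fun _ _ => by ring
  have hface : ∀ e, (M.faceIntegral e fun y => ∑ b, (∑ l, (∑ s, M.normal e s * A s b l)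
        * M.avg e (U l) y) * M.jump e (Pi.single (M := fun _ => M.Fn) a H b) y)
      = M.faceIntegral e fun y =>
        (∑ s, M.normal e s * M.avg e (∑ l, A s a l • U l) y) * M.jump e H y := by
    intro e
    congr 1
    funext y
    simp only [hval'', mul_ite, mul_zero, Finset.sum_ite_eq', Finset.mem_univ, if_true, avg_sum,
      Finset.sum_mul, Finset.mul_sum]
    rw [Finset.sum_comm]
    exact Finset.sum_congr rfl fun _ _ => Finset.sum_congr rfl fun _ _ => by ring
  have i1 : IsInt ((1 / τ) • ((U' a - U a) * H)) := fun T =>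
    (((hU' a).isC0.isInt T).sub ((hU a).isC0.isInt T)).mul_continuousOn
      (hH.isC0 T).continuousOn (M.isCompact_elem T) |>.const_mul (1 / τ)
  have i2 : ∀ s, IsInt ((∑ l, A s a l • U l) * M.pd s H) := fun s =>
    ((hY s).isC0.mul (hH.pd s)).isInt
  have hsum : ∀ {ι' : Type} [Fintype ι'] {G : ι' → M.Fn} (_ : ∀ l, IsInt (G l)) (b : ι' → ℝ),
      IsInt (∑ l, b l • G l) := by
    intro ι' _ G hG b T
    have : (∑ l, b l • G l) T = fun x => ∑ l, b l * G l T x := by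
      funext x; simp [Finset.sum_apply]
    rw [this]
    exact integrable_finsetSum _ fun l _ => (hG l T).const_mul (b l)
  have i3 : ∀ s, IsInt ((∑ l, B s a l • (fun T x => c s x * U l T x : M.Fn)) * H) := fun s =>
    (hsum (hZ s) _).mul_isC0 hH.isC0
  have i23 : IsInt (∑ s, (-1 : ℝ) • ((∑ l, A s a l • U l) * M.pd s H)
      + ∑ s, (1 : ℝ) • ((∑ l, B s a l • (fun T x => c s x * U l T x : M.Fn)) * H)) := fun T =>
    (hsum i2 (fun _ => -1) T).add (hsum i3 (fun _ => 1) T)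
  unfold eulerForm
  rw [hvol, integral_add i1 i23, integral_add (hsum i2 _) (hsum i3 _), integral_smul,
    integral_sum i2, integral_sum i3]
  simp_rw [hface]
  rw [← weak_divergence_eq hY hH, ← ip_sub_left (hU' a).isC0 (hU a).isC0 hH.isC0]
  simp_rw [← ip_sum_left (hZ _) _ hH.isC0]
  simp only [neg_one_mul, one_mul, Finset.sum_neg_distrib]
  simp_rw [ip_eq]
  ring

end DiscreteDerivative

end PeriodicMesh

open PeriodicMesh

/-! ### Conservation in one step -/

section Step

variable {k : ℕ} {Mx Mv : PeriodicMesh (k + 1)} {p q m : ℕ} {U : Fin m → Mv.Fn}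

lemma State.IsBlockQR.isC1_V {st : State Mx Mv m} (h : st.IsBlockQR p q U) (j) :
    IsC1 (st.V U j) := isC1_of_mem_dg (h.V_mem j)

lemma State.IsBlockQR.isC1_U {st : State Mx Mv m} (h : st.IsBlockQR p q U) (a) :
    IsC1 (U a) := h.isC1_V (Sum.inl a)

lemma State.IsBlockQR.K_mem {st : State Mx Mv m} (h : st.IsBlockQR p q U) (j) :
    st.K j ∈ Mx.dg p :=
  Submodule.sum_mem _ fun i _ => Submodule.smul_mem _ _ (h.X_mem i)

lemma State.IsBlockQR.isC1_K {st : State Mx Mv m} (h : st.IsBlockQR p q U) (j) :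
    IsC1 (st.K j) := isC1_of_mem_dg (h.K_mem j)

lemma wip_comm (M : PeriodicMesh (k + 1)) (V W : M.Fn) : wip M V W = wip M W V := by
  unfold wip ip wmul
  congr 1
  funext i x
  ring

/-- The discrete flux that belongs to the velocity function `V_j`. -/
noncomputable def State.flux (st : State Mx Mv m) (U : Fin m → Mv.Fn) (s : Fin (k + 1))
    (j : Fin m ⊕ Fin st.k) : Mx.Fn := ∑ l, st.Ax U s j l • st.K l

/-- Multiplication with a component of the negative electric field. -/
def mulField {M : PeriodicMesh (k + 1)} (E : Eu (k + 1) → Eu (k + 1)) (s : Fin (k + 1))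
    (G : M.Fn) : M.Fn := fun T x => -(E x s) * G T x

lemma isInt_mulField {M : PeriodicMesh (k + 1)} {E : Eu (k + 1) → Eu (k + 1)}
    (hE : ∀ s T, IntegrableOn (fun x => E x s) (M.elem T)) (s : Fin (k + 1)) {G : M.Fn}
    (hG : IsC0 G) : IsInt (mulField E s G) :=
  (show IsInt (fun _ x => -(E x s) : M.Fn) from fun T => (hE s T).neg).mul_isC0 hG

lemma mulField_sum {M : PeriodicMesh (k + 1)} {ι : Type*} [Fintype ι]
    (E : Eu (k + 1) → Eu (k + 1)) (s : Fin (k + 1)) (G : ι → M.Fn) (c : ι → ℝ) :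
    mulField E s (∑ l, c l • G l) = ∑ l, c l • mulField E s (G l) := by
  funext T x
  simp only [mulField, Finset.sum_apply, Pi.smul_apply, smul_eq_mul, Finset.mul_sum]
  exact Finset.sum_congr rfl fun _ _ => by ring

/-- The K-step in terms of discrete derivatives. -/
lemma State.IsKStep.eq {st : State Mx Mv m} (h : st.IsBlockQR p q U) {τ : ℝ}
    {E : Eu (k + 1) → Eu (k + 1)} (hE : ∀ s T, IntegrableOn (fun x => E x s) (Mx.elem T))
    {K' : Fin m ⊕ Fin st.k → Mx.Fn} (hK : st.IsKStep p U τ E K') (j : Fin m ⊕ Fin st.k)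
    {ψ : Mx.Fn} (hψ : ψ ∈ Mx.dg p) :
    1 / τ * (Mx.ip (K' j) ψ - Mx.ip (st.K j) ψ) + ∑ s, Mx.discDeriv s (st.flux U s j) ψ
      + ∑ s, ∑ l, st.Bx U s j l * Mx.ip (mulField E s (st.K l)) ψ = 0 := by
  have h1 := hK.2 (Pi.single j ψ) (by
    intro l
    by_cases hl : l = j
    · subst hl; rwa [Pi.single_eq_same]
    · rw [Pi.single_eq_of_ne hl]; exact zero_mem _)
  rw [eulerForm_single τ _ _ (c := fun s x => -(E x s)) (fun s T => (hE s T).neg) h.isC1_K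
    (fun l => isC1_of_mem_dg (hK.1 l)) (isC1_of_mem_dg hψ)] at h1
  exact h1

/-- Applied to `K^{n+1}_a`, which the augmentation places in the span of the `X̃_μ`: projecting onto
the augmented basis loses nothing. -/
lemma eq_sum_ip_of_mem_span {M : PeriodicMesh (k + 1)} {r : ℕ} {X : Fin r → M.Fn}
    (hX : ∀ μ, IsC1 (X μ)) (ho : ∀ μ μ', M.ip (X μ) (X μ') = if μ = μ' then 1 else 0)
    {G : M.Fn} (hG : G ∈ Submodule.span ℝ (Set.range X)) : G = ∑ μ, M.ip (X μ) G • X μ := by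
  obtain ⟨c, rfl⟩ := (Submodule.mem_span_range_iff_exists_fun ℝ).1 hG
  refine Finset.sum_congr rfl fun μ _ => ?_
  rw [ip_sum_right (fun l => (hX l).isC0.isInt) c (hX μ).isC0]
  simp [ho]

/-- The coefficients of the S-step that belong to the fixed velocity functions are those of the
K-step. -/
lemma BUGStep.K_fixed_eq {τ : ℝ} (hτ : τ ≠ 0) {E : Eu (k + 1) → Eu (k + 1)}
    (hE : ∀ s T, IntegrableOn (fun x => E x s) (Mx.elem T)) {st st' : State Mx Mv m}
    (h : st.IsBlockQR p q U) (B : BUGStep p q U τ E st st') (a : Fin m) :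
    st'.K (Sum.inl a) = B.K' (Sum.inl a) := by
  have hXt : ∀ μ, IsC1 (B.Xt μ) := fun μ => isC1_of_mem_dg (B.Xt_mem μ)
  have hX : ∀ i, IsC1 (st.X i) := fun i => isC1_of_mem_dg (h.X_mem i)
  rw [B.K_fixed, eq_sum_ip_of_mem_span hXt B.Xt_orthonormal (B.K_mem_span (Sum.inl a))]
  refine Finset.sum_congr rfl fun μ _ => ?_
  congr 1
  have hK := B.kStep.eq h hE (Sum.inl a) (B.Xt_mem μ)
  -- `U_a` is also one of the old orthonormal velocity functions, so the sum over `j` collapses to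
  -- the single column that defines `K_a`.
  have h1 : ∑ i, ∑ j, Mx.ip (B.Xt μ) (st.X i) * st.S i j
      * wip Mv (Sum.elim U B.Wt (Sum.inl a)) (st.V U j) = Mx.ip (st.K (Sum.inl a)) (B.Xt μ) := by
    have hw : ∀ j, wip Mv (Sum.elim U B.Wt (Sum.inl a)) (st.V U j)
        = if Sum.inl a = j then 1 else 0 := fun j => h.V_orthonormal (Sum.inl a) j
    simp_rw [hw]
    rw [State.K, ip_sum_left (fun i => (hX i).isC0.isInt) _ (hXt μ).isC0]
    simp [mul_comm, ip_comm (B.Xt μ)]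
  have h2 : ∀ s, ∑ i, ∑ j, Mx.discDeriv s (st.X i) (B.Xt μ) * st.S i j
      * wip Mv (Sum.elim U B.Wt (Sum.inl a)) (vmul s (st.V U j))
      = Mx.discDeriv s (st.flux U s (Sum.inl a)) (B.Xt μ) := by
    intro s
    rw [State.flux, discDeriv_sum_left s h.isC1_K _ (hXt μ), Finset.sum_comm]
    refine Finset.sum_congr rfl fun j _ => ?_
    rw [State.K, discDeriv_sum_left s hX _ (hXt μ), Finset.mul_sum]
    refine Finset.sum_congr rfl fun i _ => ?_
    rw [wip_comm]
    simp only [State.Ax, Matrix.of_apply, State.V, Sum.elim_inl]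
    ring
  have h3 : ∀ s, ∑ i, ∑ j, Mx.ip (B.Xt μ) (fun T x => -(E x s) * st.X i T x) * st.S i j
      * Mv.discDeriv s (wmul (st.V U j)) (Sum.elim U B.Wt (Sum.inl a))
      = ∑ l, st.Bx U s (Sum.inl a) l * Mx.ip (mulField E s (st.K l)) (B.Xt μ) := by
    intro s
    rw [Finset.sum_comm]
    refine Finset.sum_congr rfl fun j _ => ?_
    rw [State.K, mulField_sum, ip_sum_left (fun i => isInt_mulField hE s (hX i).isC0) _
      (hXt μ).isC0, Finset.mul_sum]
    refine Finset.sum_congr rfl fun i _ => ?_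
    rw [ip_comm (B.Xt μ)]
    change Mx.ip (mulField E s (st.X i)) _ * _ * _ = _
    simp only [State.Bx, Matrix.of_apply, State.V, Sum.elim_inl]
    ring
  have h4 : ∀ F : (Fin m ⊕ Fin st.k) → (Fin m ⊕ Fin st.k) → Fin (k + 1) → ℝ,
      ∑ i, ∑ j, ∑ s, F i j s = ∑ s, ∑ i, ∑ j, F i j s := by
    intro F
    rw [Finset.sum_comm]
    simp_rw [Finset.sum_comm (s := (Finset.univ : Finset (Fin m ⊕ Fin st.k)))
      (t := (Finset.univ : Finset (Fin (k + 1))))]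
    exact Finset.sum_congr rfl fun _ _ => Finset.sum_comm
  rw [B.sStep, h1, h4]
  simp_rw [Finset.sum_add_distrib]
  simp_rw [h2, h3]
  rw [ip_comm (B.Xt μ)]
  -- The K-step tested with `X̃_μ` and the S-step entry are now the same explicit Euler update, up
  -- to the factor `τ`.
  rw [add_assoc, add_eq_zero_iff_eq_neg] at hK
  field_simp at hK
  linarith

/-- Moments of the density as combinations of the functions `K_j`. -/
lemma State.integral_density {st : State Mx Mv m} (h : st.IsBlockQR p q U) {c : Fin m → ℝ}
    (hc : ∑ a, c a • U a = fun _ _ => 1) (φ : Eu (k + 1) → ℝ) (hφ : Continuous φ) :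
    (fun T x => Mv.integral fun T' v => φ v * st.density U T x T' v : Mx.Fn)
      = ∑ a, c a • ∑ j, wip Mv (fun T' v => φ v * st.V U j T' v) (U a) • st.K j := by
  have hV : ∀ j, IsC0 (wmul (fun T' v => φ v * st.V U j T' v : Mv.Fn)) := fun j T' => by
    have h1 := (h.isC1_V j).isC0 T'
    have h2 : Continuous (weight : Eu (k + 1) → ℝ) := by unfold weight; fun_prop
    unfold wmul
    fun_prop
  -- Inserting `1 = ∑ c_a U_a` turns the plain integral into weighted inner products with the `U_a`.
  have hw : ∀ j, Mv.integral (wmul fun T' v => φ v * st.V U j T' v)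
      = ∑ a, c a * wip Mv (fun T' v => φ v * st.V U j T' v) (U a) := by
    intro j
    unfold wip
    rw [← ip_sum_right (fun a => (h.isC1_U a).isC0.isInt) c (hV j), hc, ip_eq]
    congr 1
    funext T' v
    simp
  funext T x
  have h1 : (fun T' v => φ v * st.density U T x T' v : Mv.Fn)
      = ∑ j, st.K j T x • wmul fun T' v => φ v * st.V U j T' v := by
    funext T' v
    simp only [State.density, wmul, State.K, Finset.sum_apply, Pi.smul_apply, smul_eq_mul]
    rw [Finset.sum_comm, Finset.mul_sum, Finset.mul_sum]
    refine Finset.sum_congr rfl fun j _ => ?_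
    rw [Finset.mul_sum, Finset.mul_sum, Finset.sum_mul]
    exact Finset.sum_congr rfl fun i _ => by ring
  rw [h1, integral_sum fun j => (hV j).isInt]
  simp_rw [hw]
  simp only [Finset.sum_apply, Pi.smul_apply, smul_eq_mul, Finset.mul_sum]
  rw [Finset.sum_comm]
  exact Finset.sum_congr rfl fun _ _ => Finset.sum_congr rfl fun _ _ => by ring

lemma State.rho_eq {st : State Mx Mv m} (h : st.IsBlockQR p q U) {c : Fin m → ℝ}
    (hc : ∑ a, c a • U a = fun _ _ => 1) : st.rho U = ∑ a, c a • st.K (Sum.inl a) := by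
  have h1 := State.integral_density h hc (fun _ => 1) continuous_const
  simp only [one_mul] at h1
  refine h1.trans (Finset.sum_congr rfl fun a _ => ?_)
  congr 1
  have hw : ∀ j, wip Mv (fun T' v => st.V U j T' v) (U a) = if j = Sum.inl a then 1 else 0 :=
    fun j => h.V_orthonormal j (Sum.inl a)
  simp_rw [hw]
  simp

/-- The weights `(v_s V_j, U_a)_{v,ω}` are row `a` of `A^{(x,s)}`, so the momentum density is built
from the very fluxes that appear in the K-step. -/
lemma State.current_eq {st : State Mx Mv m} (h : st.IsBlockQR p q U) {c : Fin m → ℝ}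
    (hc : ∑ a, c a • U a = fun _ _ => 1) (s : Fin (k + 1)) :
    st.current U s = ∑ a, c a • st.flux U s (Sum.inl a) :=
  State.integral_density h hc (fun v => v s) (by fun_prop)

lemma State.IsBlockQR.flux_mem {st : State Mx Mv m} (h : st.IsBlockQR p q U) (s j) :
    st.flux U s j ∈ Mx.dg p :=
  Submodule.sum_mem _ fun l _ => Submodule.smul_mem _ _ (h.K_mem l)

lemma State.IsBlockQR.rho_mem {st : State Mx Mv m} (h : st.IsBlockQR p q U) {c : Fin m → ℝ}
    (hc : ∑ a, c a • U a = fun _ _ => 1) : st.rho U ∈ Mx.dg p := by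
  rw [State.rho_eq h hc]
  exact Submodule.sum_mem _ fun a _ => Submodule.smul_mem _ _ (h.K_mem _)

lemma State.IsBlockQR.current_mem {st : State Mx Mv m} (h : st.IsBlockQR p q U) {c : Fin m → ℝ}
    (hc : ∑ a, c a • U a = fun _ _ => 1) (s) : st.current U s ∈ Mx.dg p := by
  rw [State.current_eq h hc]
  exact Submodule.sum_mem _ fun a _ => Submodule.smul_mem _ _ (h.flux_mem s _)

/-- The fixed velocity functions see no contribution of the electric field to the mass balance. -/
lemma State.IsBlockQR.sum_Bx_eq_zero {st : State Mx Mv m} (h : st.IsBlockQR p q U)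
    {c : Fin m → ℝ} (hc : ∑ a, c a • U a = fun _ _ => 1) (s) (l) :
    ∑ a, c a * st.Bx U s (Sum.inl a) l = 0 := by
  have h1 := discDeriv_sum_right s (fun a => h.isC1_U a) c (isC1_wmul (h.isC1_V l))
  rw [hc, discDeriv_one_right s (isC1_wmul (h.isC1_V l))] at h1
  exact h1.symm

/-- The discrete continuity equation for one step. -/
theorem BUGStep.continuity {τ : ℝ} (hτ : τ ≠ 0) {E : Eu (k + 1) → Eu (k + 1)}
    (hE : ∀ s T, IntegrableOn (fun x => E x s) (Mx.elem T)) {st st' : State Mx Mv m}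
    (h : st.IsBlockQR p q U) (B : BUGStep p q U τ E st st') {c : Fin m → ℝ}
    (hc : ∑ a, c a • U a = fun _ _ => 1) {ψ : Mx.Fn} (hψ : ψ ∈ Mx.dg p) :
    1 / τ * Mx.ip (st'.rho U - st.rho U) ψ
      - (Mx.integral fun T x => ∑ s, st.current U s T x * Mx.pd s ψ T x)
      + ∑ e, Mx.faceIntegral e (fun y =>
          (∑ s, Mx.normal e s * Mx.avg e (st.current U s) y) * Mx.jump e ψ y) = 0 := by
  have hψ1 := isC1_of_mem_dg hψ
  have hcur : ∀ s, IsC1 (st.current U s) := fun s => isC1_of_mem_dg (h.current_mem hc s)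
  have h1 : (Mx.integral fun T x => ∑ s, st.current U s T x * Mx.pd s ψ T x)
      = ∑ s, Mx.ip (st.current U s) (Mx.pd s ψ) := by
    have := integral_sum (G := fun s => st.current U s * Mx.pd s ψ)
      (fun s => ((hcur s).isC0.mul (hψ1.pd s)).isInt) fun _ => 1
    simp only [one_mul] at this
    rw [funext fun s => ip_eq (st.current U s) (Mx.pd s ψ), ← this]
    congr 1
    funext T x
    simp [Finset.sum_apply]
  rw [h1, sub_eq_add_neg _ (∑ s, _), add_assoc, weak_divergence_eq hcur hψ1,
    ip_sub_left (isC1_of_mem_dg (B.blockQR.rho_mem hc)).isC0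
      (isC1_of_mem_dg (h.rho_mem hc)).isC0 hψ1.isC0,
    State.rho_eq B.blockQR hc, State.rho_eq h hc,
    ip_sum_left (fun a => (B.blockQR.isC1_K _).isC0.isInt) c hψ1.isC0,
    ip_sum_left (fun a => (h.isC1_K _).isC0.isInt) c hψ1.isC0]
  simp_rw [fun s => State.current_eq h hc s, fun s => discDeriv_sum_left s
    (fun a => isC1_of_mem_dg (h.flux_mem s (Sum.inl a))) c hψ1]
  have h2 : ∑ a, c a * ∑ s, ∑ l, st.Bx U s (Sum.inl a) l * Mx.ip (mulField E s (st.K l)) ψ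
      = 0 := by
    simp_rw [Finset.mul_sum]
    rw [Finset.sum_comm]
    refine Finset.sum_eq_zero fun s _ => ?_
    rw [Finset.sum_comm]
    refine Finset.sum_eq_zero fun l _ => ?_
    simp_rw [← mul_assoc]
    rw [← Finset.sum_mul, h.sum_Bx_eq_zero hc, zero_mul]
  -- The combination of the K-step equations with weights `c a`, where the result of the K-step has
  -- been replaced by the functions `K_a` of the truncated state.
  have h3 : ∑ a, c a * (1 / τ * (Mx.ip (st'.K (Sum.inl a)) ψ - Mx.ip (st.K (Sum.inl a)) ψ)
      + ∑ s, Mx.discDeriv s (st.flux U s (Sum.inl a)) ψ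
      + ∑ s, ∑ l, st.Bx U s (Sum.inl a) l * Mx.ip (mulField E s (st.K l)) ψ) = 0 := by
    refine Finset.sum_eq_zero fun a _ => ?_
    rw [B.K_fixed_eq hτ hE h, B.kStep.eq h hE _ hψ, mul_zero]
  simp_rw [mul_add, Finset.sum_add_distrib] at h3
  rw [h2, add_zero] at h3
  rw [← h3, Finset.sum_comm, ← Finset.sum_sub_distrib, Finset.mul_sum]
  congr 1
  · exact Finset.sum_congr rfl fun _ _ => by ring
  · simp_rw [Finset.mul_sum]

/-- Mass is conserved in one step. -/
theorem BUGStep.integral_rho_eq {τ : ℝ} (hτ : τ ≠ 0) {E : Eu (k + 1) → Eu (k + 1)}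
    (hE : ∀ s T, IntegrableOn (fun x => E x s) (Mx.elem T)) {st st' : State Mx Mv m}
    (h : st.IsBlockQR p q U) (B : BUGStep p q U τ E st st') {c : Fin m → ℝ}
    (hc : ∑ a, c a • U a = fun _ _ => 1) :
    Mx.integral (st'.rho U) = Mx.integral (st.rho U) := by
  have hone : (fun _ _ => 1 : Mx.Fn) ∈ Mx.dg p := fun _ => ⟨1, by simp, fun _ => by simp⟩
  have h1 := B.continuity hτ hE h hc hone
  simp only [pd_one, jump_one, Pi.zero_apply, mul_zero, Finset.sum_const_zero] at h1
  rw [ip_sub_left (isC1_of_mem_dg (B.blockQR.rho_mem hc)).isC0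
      (isC1_of_mem_dg (h.rho_mem hc)).isC0 isC1_one.isC0] at h1
  simp only [PeriodicMesh.integral, faceIntegral, MeasureTheory.integral_zero,
    Finset.sum_const_zero, sub_zero, add_zero] at h1
  have h2 := (mul_eq_zero.1 h1).resolve_left (one_div_ne_zero hτ)
  simpa [ip, sub_eq_zero] using h2

end Step

end DLRA

theorem mainTheorem1 {d : ℕ} (hd : 0 < d) (Mx Mv : DLRA.PeriodicMesh d) (p q : ℕ)
    {m : ℕ} (hm : 1 ≤ m) (U : Fin m → Mv.Fn)
    (hU : (fun _ _ => 1 : Mv.Fn) ∈ Submodule.span ℝ (Set.range U))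
    (τ : ℝ) (hτ : 0 < τ)
    (E : ℕ → DLRA.Eu d → DLRA.Eu d)
    (hE : ∀ n s T, MeasureTheory.IntegrableOn (fun x => E n x s) (Mx.elem T))
    (st : ℕ → DLRA.State Mx Mv m) (h0 : (st 0).IsBlockQR p q U)
    (step : ∀ n, DLRA.BUGStep p q U τ (E n) (st n) (st (n + 1))) :
    (∀ n, (st n).rho U ∈ Mx.dg p ∧ ∀ s, (st n).current U s ∈ Mx.dg p) ∧
    (∀ n, ∀ ψ ∈ Mx.dg p,
      1 / τ * Mx.ip ((st (n + 1)).rho U - (st n).rho U) ψ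
        - (Mx.integral fun T x => ∑ s, (st n).current U s T x * Mx.pd s ψ T x)
        + ∑ e, Mx.faceIntegral e (fun y =>
            (∑ s, Mx.normal e s * Mx.avg e ((st n).current U s) y) * Mx.jump e ψ y) = 0) ∧
    (∀ n, Mx.integral ((st n).rho U) = Mx.integral ((st 0).rho U)) := by
  -- Positivity of `d` allows one coordinate to be split off; the surface dimension `d - 1` is then
  -- `k`.
  obtain ⟨k, rfl⟩ : ∃ k, d = k + 1 := ⟨d - 1, by omega⟩
  obtain ⟨c, hc⟩ := (Submodule.mem_span_range_iff_exists_fun ℝ).1 hU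
  have hQR : ∀ n, (st n).IsBlockQR p q U := fun n => by
    cases n with
    | zero => exact h0
    | succ n => exact (step n).blockQR
  refine ⟨fun n => ⟨(hQR n).rho_mem hc, (hQR n).current_mem hc⟩, fun n ψ hψ =>
    (step n).continuity hτ.ne' (hE n) (hQR n) hc hψ, fun n => ?_⟩
  induction n with
  | zero => rfl
  | succ n ih => rw [← ih, (step n).integral_rho_eq hτ.ne' (hE n) (hQR n) hc]
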